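/- **Bubble-neck decomposition.** Let $\Sigma$ be a closed two-dimensional manifold and $m\ge 3$. A *weak immersion* $\vec\xi:\Sigma\to\mathbb R^m$ is a Lipschitz map such that, for some smooth reference metric $g_0$ and some $c_0>0$, $|d\vec\xi\wedge d\vec\xi|_{g_0}\ge c_0$ almost everywhere, and whose Gauss map $\vec n_{\vec\xi}=\star\,\frac{\partial_{x_1}\vec\xi\wedge\partial_{x_2}\vec\xi}{|\partial_{x_1}\vec\xi\wedge\partial_{x_2}\vec\xi|}$ is weakly differentiable with $\int_\Sigma|d\vec n_{\vec\xi}|_g^2\,dvol_g<\infty$, where $g=\vec\xi^*g_{\mathbb R^m}$. Let $\vec\xi_k$ be a sequence of weak immersions and put $g_k=\vec\xi_k^*g_{\mathbb R^m}$ and $E_k(A)=\int_A|d\vec n_{\vec\xi_k}|^2_{g_k}\,dvol_{g_k}$. Assume $E_k(\Sigma)\le\Lambda$ for all $k$, and that $g_k$ is conformally equivalent to a smooth metric $h_k$ of constant scalar curvature, where $h_k\to h_\infty$ in $C^l(\Sigma)$ for every $l\in\mathbb N$ and $h_\infty$ is a metric of constant scalar curvature. Assume that there are distinct points $a^1,\dots,a^n\in\Sigma$,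 $R>0$ and a map $\vec\xi_\infty$ with (i) $\limsup_k\mathcal H^2(\vec\xi_k(\Sigma))<\infty$; (ii) $\vec\xi_k(\Sigma)\subset B_R(0)$ for all $k$; (iii) $\vec\xi_k\rightharpoonup\vec\xi_\infty$ weakly in $W^{2,2}_{loc}$ and weakly-$*$ in $W^{1,\infty}_{loc}$ on $\Sigma\setminus\{a^1,\dots,a^n\}$; (iv) $\limsup_k\|\log|d\vec\xi_k|_{h_k}\|_{L^\infty(K)}<\infty$ for every compact $K\subset\Sigma\setminus\{a^1,\dots,a^n\}$. Let $0<\varepsilon_0<8\pi/3$. Below, $B_r(x)$ and $|x-y|$ denote open geodesic balls and geodesic distance for $h_k$. Then, after passing to a subsequence (still indexed by $k\in\mathbb N$), there are integers $Q^1,\dots,Q^n\ge0$, and for $1\le i\le n$, $1\le j\le Q^i$ points $x_k^{i,j}\in\Sigma$ and radii $\rho_k^{i,j}>0$, such that the following hold (all statements are for all $k$, all $i$ and all $j\le Q^i$, unless a limit in $k$ is taken). 1. $x_k^{i,j}\to a^i$ and $\rho_k^{i,j}\to0$ as $k\to\infty$. 2. For $j\ne j'$, either $\displaystyle\lim_k\Big(\frac{\rho_k^{i,j}}{\rho_k^{i,j'}}+\frac{\rho_k^{i,j'}}{\rho_k^{i,j}}\Big)=\infty$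 or $\displaystyle\lim_k\frac{|x_k^{i,j}-x_k^{i,j'}|}{\rho_k^{i,j}+\rho_k^{i,j'}}=\infty$. 3. $E_k\big(B_{\rho_k^{i,j}}(x_k^{i,j})\big)\ge\varepsilon_0$. 4. The index set $I^{i,j}=\{j'\,:\,x_k^{i,j'}\in B_{\rho_k^{i,j}}(x_k^{i,j}),\ \rho_l^{i,j}/\rho_l^{i,j'}\to\infty \text{ as } l\to\infty\}$ does not depend on $k$. 5. For $0<\alpha<1$ define the neck region $\Omega_k(\alpha)=\bigcup_{i}\big(\Omega_k^i(\alpha)\cup\bigcup_{j}\Omega_k^{i,j}(\alpha)\big)$, where $$\Omega_k^i(\alpha)=B_\alpha(a^i)\setminus\bigcup_{j}B_{\alpha^{-1}\rho_k^{i,j}}(x_k^{i,j}),\qquad \Omega_k^{i,j}(\alpha)=\bigcup_{j'\in I^{i,j}}\Big(B_{\alpha\rho_k^{i,j}}(x_k^{i,j'})\setminus\bigcup_{j''\in I^{i,j}}B_{\alpha^{-1}\rho_k^{i,j''}}(x_k^{i,j''})\Big).$$ For every $\beta>1$ there is $\alpha\in(0,1)$, independent of $k$, such that * for every $x\in\Sigma$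 and every $\rho>0$ with $B_{2\beta\rho}(x)\setminus B_{\rho/\beta}(x)\subset\Omega_k(\alpha)$ one has $E_k\big(B_{2\rho}(x)\setminus B_\rho(x)\big)<\varepsilon_0$; and * $E_k\Big(B_{\rho_k^{i,j}}(x_k^{i,j})\setminus\bigcup_{j'\in I^{i,j}}B_{\alpha\rho_k^{i,j}}(x_k^{i,j'})\Big)\ge\varepsilon_0$. 6. For every $\alpha\in(0,1)$ let $r_k^{i,j}$ be the infimum ($+\infty$ if there are none) of all $r\in(0,\rho_k^{i,j})$ for which there is a ball $B_r(x)\subset B_{\alpha^{-1}\rho_k^{i,j}}(x_k^{i,j})\setminus\bigcup_{j'\in I^{i,j}}B_{\alpha\rho_k^{i,j}}(x_k^{i,j'})$ with $E_k(B_r(x))=\varepsilon_0$. Then $\displaystyle\liminf_k r_k^{i,j}/\rho_k^{i,j}>0$. -/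

import Mathlib

open Set Filter MeasureTheory
open Bundle
open scoped Topology ENNReal NNReal Manifold ContDiff

noncomputable section

namespace BubbleNeck

/-- The model plane `ℝ²` with its Euclidean norm. -/
abbrev Plane : Type := EuclideanSpace ℝ (Fin 2)

/-- The standard basis vectors of the plane. -/
def basisVec (i : Fin 2) : Plane := EuclideanSpace.single i 1

/-- Classical partial derivative `∂ᵢ f` of a function of two variables. For locally Lipschitz `f`
it exists almost everywhere and is the weak derivative. -/
def pd {F : Type*} [NormedAddCommGroup F] [NormedSpace ℝ F] (i : Fin 2) (f : Plane → F) :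
    Plane → F :=
  fun x => fderiv ℝ f x (basisVec i)

/-! ### Weak derivatives -/

/-- `v` is the weak partial derivative `∂ᵢ f` on the open set `U`. -/
structure HasWeakPartial {F : Type*} [NormedAddCommGroup F] [NormedSpace ℝ F]
    (U : Set Plane) (i : Fin 2) (f v : Plane → F) : Prop where
  locInt : LocallyIntegrableOn f U
  locInt_deriv : LocallyIntegrableOn v U
  integral_eq : ∀ φ : Plane → ℝ, ContDiff ℝ ∞ φ → HasCompactSupport φ → tsupport φ ⊆ U →
    ∫ x, pd i φ x • f x = - ∫ x, φ x • v x

open Classical in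
/-- The weak partial derivative `∂ᵢ f` on `U` (unique almost everywhere on `U` if it exists). -/
def weakPartial {F : Type*} [NormedAddCommGroup F] [NormedSpace ℝ F]
    (U : Set Plane) (i : Fin 2) (f : Plane → F) : Plane → F :=
  if h : ∃ v, HasWeakPartial U i f v then h.choose else 0

/-! ### Riemannian metrics on a surface -/

section Metrics

variable {S : Type*} [TopologicalSpace S] [ChartedSpace Plane S] [IsManifold (𝓡 2) ∞ S]

variable (S) in
/-- Smooth Riemannian metrics on the surface `S`. -/
abbrev Metric : Type _ :=
  Bundle.ContMDiffRiemannianMetric (𝓡 2) ∞ Plane (fun x : S => TangentSpace (𝓡 2) x)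

/-- The coefficients `h_{ij}` of the metric `h` in the chart `e`, as functions on `e.target`. -/
def metricCoef (h : Metric S) (e : OpenPartialHomeomorph S Plane) (i j : Fin 2) (x : Plane) : ℝ :=
  h.inner (e.symm x) (mfderiv (𝓡 2) (𝓡 2) e.symm x (basisVec i))
    (mfderiv (𝓡 2) (𝓡 2) e.symm x (basisVec j))

/-- The matrix `(h_{ij})` of the metric `h` in the chart `e`. -/
def metricMatrix (h : Metric S) (e : OpenPartialHomeomorph S Plane) (x : Plane) :
    Matrix (Fin 2) (Fin 2) ℝ :=
  Matrix.of fun i j => metricCoef h e i j x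

/-- Christoffel symbols `Γ^k_{ij}` of a metric `G` given in coordinates. -/
def christoffel (G : Plane → Matrix (Fin 2) (Fin 2) ℝ) (k i j : Fin 2) (x : Plane) : ℝ :=
  (1 / 2) * ∑ l, (G x)⁻¹ k l *
    (pd i (fun y => G y j l) x + pd j (fun y => G y i l) x - pd l (fun y => G y i j) x)

/-- Ricci curvature `R_{ij}` of a metric `G` given in coordinates. -/
def ricci (G : Plane → Matrix (Fin 2) (Fin 2) ℝ) (i j : Fin 2) (x : Plane) : ℝ :=
  ∑ k, (pd k (christoffel G k i j) x - pd j (christoffel G k i k) x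
    + ∑ l, (christoffel G k k l x * christoffel G l i j x
      - christoffel G k j l x * christoffel G l i k x))

/-- Scalar curvature of a metric `G` given in coordinates. -/
def scalarCurvature (G : Plane → Matrix (Fin 2) (Fin 2) ℝ) (x : Plane) : ℝ :=
  ∑ i, ∑ j, (G x)⁻¹ i j * ricci G i j x

/-- `h` has constant scalar curvature. -/
def HasConstScalarCurvature (h : Metric S) : Prop :=
  ∃ c : ℝ, ∀ e ∈ atlas Plane S, ∀ x ∈ e.target, scalarCurvature (metricMatrix h e) x = c

/-- `h_k → h∞` in `C^l` for every `l`: in every chart all derivatives of the coefficients converge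
uniformly on compact sets. -/
def SmoothConverges (h : ℕ → Metric S) (hlim : Metric S) : Prop :=
  ∀ l : ℕ, ∀ e ∈ atlas Plane S, ∀ K ⊆ e.target, IsCompact K → ∀ i j : Fin 2,
    TendstoUniformlyOn (fun k => iteratedFDeriv ℝ l (metricCoef (h k) e i j))
      (iteratedFDeriv ℝ l (metricCoef hlim e i j)) atTop K

/-- The geodesic distance of the metric `h`: infimum of the lengths of `C¹` paths (infinite
between different connected components). -/
def geodEDist (h : Metric S) (x y : S) : ℝ≥0∞ :=
  letI : RiemannianBundle (fun x : S => TangentSpace (𝓡 2) x) := ⟨h.toRiemannianMetric⟩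
  Manifold.riemannianEDist (𝓡 2) x y

/-- The geodesic distance as a real number. -/
def geodDist (h : Metric S) (x y : S) : ℝ := (geodEDist h x y).toReal

/-- The open geodesic ball `B_r(x)` of the metric `h`. -/
def gball (h : Metric S) (x : S) (r : ℝ) : Set S := {y | geodEDist h x y < ENNReal.ofReal r}

end Metrics

/-! ### Weak immersions and the energy of the Gauss map -/

/-- The space `Λ²ℝᵐ`, in Plücker coordinates with respect to the orthonormal basis
`(e_p ∧ e_q)_{p<q}`. -/
abbrev Bivec (m : ℕ) : Type := EuclideanSpace ℝ {p : Fin m × Fin m // p.1 < p.2}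

/-- The wedge product `a ∧ b`. -/
def wedge {m : ℕ} (a b : EuclideanSpace ℝ (Fin m)) : Bivec m :=
  WithLp.toLp 2 fun p => a p.1.1 * b p.1.2 - a p.1.2 * b p.1.1

/-- The Gauss map `∂₁f ∧ ∂₂f / |∂₁f ∧ ∂₂f|` of a parametrized surface. The Hodge star is a constant
linear isometry from 2-vectors onto `(m-2)`-vectors; it is left out, which does not change `|dn|`. A
change of orientation multiplies `n` by `-1` and does not change `|dn|` either. -/
def gaussMap {m : ℕ} (f : Plane → EuclideanSpace ℝ (Fin m)) (x : Plane) : Bivec m :=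
  ‖wedge (pd 0 f x) (pd 1 f x)‖⁻¹ • wedge (pd 0 f x) (pd 1 f x)

/-- The first fundamental form `g_{ij} = ⟨∂ᵢf, ∂ⱼf⟩`. -/
def firstForm {m : ℕ} (f : Plane → EuclideanSpace ℝ (Fin m)) (x : Plane) :
    Matrix (Fin 2) (Fin 2) ℝ :=
  Matrix.of fun i j => inner ℝ (pd i f x) (pd j f x)

/-- The density of `|dn|²_g dvol_g` with respect to Lebesgue measure, for a surface parametrized
over the open set `U`: `∑ g^{ij} ⟨∂ᵢn, ∂ⱼn⟩ √(det g)`, with weak derivatives of `n`. -/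
def gaussEnergyDensity {m : ℕ} (U : Set Plane) (f : Plane → EuclideanSpace ℝ (Fin m))
    (x : Plane) : ℝ :=
  (∑ i, ∑ j, (firstForm f x)⁻¹ i j *
    inner ℝ (weakPartial U i (gaussMap f) x) (weakPartial U j (gaussMap f) x)) *
  Real.sqrt (firstForm f x).det

section Surface

variable {S : Type*} [TopologicalSpace S] [ChartedSpace Plane S]

/-- The measure `|dn_ξ|²_g dvol_g` on the domain of the chart `e`, extended by zero to `S`. -/
def chartEnergy [MeasurableSpace S] {m : ℕ} (ξ : S → EuclideanSpace ℝ (Fin m))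
    (e : OpenPartialHomeomorph S Plane) : Measure S :=
  ((volume.restrict e.target).withDensity fun x =>
    ENNReal.ofReal (gaussEnergyDensity e.target (ξ ∘ e.symm) x)).map e.symm

/-- The measure `|dn_ξ|²_g dvol_g` on `S`. The measures `chartEnergy ξ e` of two charts agree on
the overlap, so that their supremum in the lattice of measures is the measure that restricts to
`chartEnergy ξ e` on the domain of each chart `e`. -/
def gaussEnergy [MeasurableSpace S] {m : ℕ} (ξ : S → EuclideanSpace ℝ (Fin m)) : Measure S :=
  ⨆ e ∈ atlas Plane S, chartEnergy ξ e

/-- Weak immersions of a closed surface: Lipschitz immersions with square-integrable second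
fundamental form. -/
structure IsWeakImmersion [IsManifold (𝓡 2) ∞ S] [MeasurableSpace S] {m : ℕ}
    (ξ : S → EuclideanSpace ℝ (Fin m)) : Prop where
  lipschitz : ∀ e ∈ atlas Plane S, LocallyLipschitzOn e.target (ξ ∘ e.symm)
  nondegenerate : ∃ g₀ : Metric S, ∃ c₀ : ℝ, 0 < c₀ ∧ ∀ e ∈ atlas Plane S,
    ∀ᵐ x ∂(volume.restrict e.target), c₀ * Real.sqrt (metricMatrix g₀ e x).det ≤
      ‖wedge (pd 0 (ξ ∘ e.symm) x) (pd 1 (ξ ∘ e.symm) x)‖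
  gauss_weak_deriv : ∀ e ∈ atlas Plane S, ∀ i : Fin 2,
    ∃ v, HasWeakPartial e.target i (gaussMap (ξ ∘ e.symm)) v
  finite_energy : gaussEnergy ξ univ < ⊤

/-- The induced metric `ξ^* g_{ℝᵐ}` is conformally equivalent to `h`. -/
def IsConformalTo [IsManifold (𝓡 2) ∞ S] {m : ℕ} (ξ : S → EuclideanSpace ℝ (Fin m))
    (h : Metric S) : Prop :=
  ∃ u : S → ℝ, (∀ x, 0 < u x) ∧ ∀ e ∈ atlas Plane S, ∀ᵐ x ∂(volume.restrict e.target),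
    firstForm (ξ ∘ e.symm) x = u (e.symm x) • metricMatrix h e x

/-- The norm `|dξ|_h` in the chart `e`. -/
def diffNorm [IsManifold (𝓡 2) ∞ S] {m : ℕ} (ξ : S → EuclideanSpace ℝ (Fin m)) (h : Metric S)
    (e : OpenPartialHomeomorph S Plane) (x : Plane) : ℝ :=
  Real.sqrt (∑ i, ∑ j, (metricMatrix h e x)⁻¹ i j * firstForm (ξ ∘ e.symm) x i j)

/-- For every compact subset `K` of `S` minus `A`, `limsup_k ‖log |dξ_k|_{h_k}‖_{L^∞(K)} < ∞`. -/
def LogDiffLocallyBounded [IsManifold (𝓡 2) ∞ S] {m : ℕ} (ξ : ℕ → S → EuclideanSpace ℝ (Fin m))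
    (h : ℕ → Metric S) (A : Set S) : Prop :=
  ∀ K : Set S, IsCompact K → K ⊆ Aᶜ → ∃ C : ℝ, ∀ᶠ k in atTop, ∀ e ∈ atlas Plane S,
    ∀ᵐ x ∂(volume.restrict (e.target ∩ e.symm ⁻¹' K)), |Real.log (diffNorm (ξ k) (h k) e x)| ≤ C

/-- `f ∈ W^{2,2}_loc(U) ∩ W^{1,∞}_loc(U)`. -/
structure MemW22LocW1InftyLoc {m : ℕ} (U : Set Plane) (f : Plane → EuclideanSpace ℝ (Fin m)) :
    Prop where
  deriv_one : ∀ i, ∃ v, HasWeakPartial U i f v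
  deriv_two : ∀ i j, ∃ v, HasWeakPartial U j (weakPartial U i f) v
  bdd : ∀ K ⊆ U, IsCompact K → MemLp f ∞ (volume.restrict K)
  bdd_one : ∀ K ⊆ U, IsCompact K → ∀ i, MemLp (weakPartial U i f) ∞ (volume.restrict K)
  sq_int_two : ∀ K ⊆ U, IsCompact K → ∀ i j,
    MemLp (weakPartial U j (weakPartial U i f)) 2 (volume.restrict K)

/-- `f_k ⇀ f` weakly in `W^{2,2}_loc(U)` and weakly-* in `W^{1,∞}_loc(U)`: on compact subsets of `U`
the functions and their first derivatives converge when tested against `L¹` (hence also against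
`L²`), and the second derivatives when tested against `L²`. -/
structure WeakStarConvergesOn {m : ℕ} (U : Set Plane) (f : ℕ → Plane → EuclideanSpace ℝ (Fin m))
    (flim : Plane → EuclideanSpace ℝ (Fin m)) : Prop where
  mem : ∀ k, MemW22LocW1InftyLoc U (f k)
  mem_lim : MemW22LocW1InftyLoc U flim
  tendsto_zero : ∀ K ⊆ U, IsCompact K → ∀ φ : Plane → ℝ, MemLp φ 1 (volume.restrict K) →
    Tendsto (fun k => ∫ x in K, φ x • f k x) atTop (𝓝 (∫ x in K, φ x • flim x))
  tendsto_one : ∀ K ⊆ U, IsCompact K → ∀ φ : Plane → ℝ, MemLp φ 1 (volume.restrict K) →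
    ∀ i, Tendsto (fun k => ∫ x in K, φ x • weakPartial U i (f k) x) atTop
      (𝓝 (∫ x in K, φ x • weakPartial U i flim x))
  tendsto_two : ∀ K ⊆ U, IsCompact K → ∀ φ : Plane → ℝ, MemLp φ 2 (volume.restrict K) →
    ∀ i j, Tendsto (fun k => ∫ x in K, φ x • weakPartial U j (weakPartial U i (f k)) x) atTop
      (𝓝 (∫ x in K, φ x • weakPartial U j (weakPartial U i flim) x))

/-- Weak convergence `ξ_k ⇀ ξ∞` in `W^{2,2}_loc ∩ (W^{1,∞}_loc)^*` on `S` minus `A`. -/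
def WeakStarConverges {m : ℕ} (ξ : ℕ → S → EuclideanSpace ℝ (Fin m))
    (ξlim : S → EuclideanSpace ℝ (Fin m)) (A : Set S) : Prop :=
  ∀ e ∈ atlas Plane S, WeakStarConvergesOn (e.target ∩ e.symm ⁻¹' Aᶜ)
    (fun k => ξ k ∘ e.symm) (ξlim ∘ e.symm)

end Surface

/-! ### Bubbles and neck regions

In this part `h k` is the metric that defines the geodesic balls at stage `k`, `x j k` and `ρ j k`
are the centers and radii of the bubbles at one concentration point (index `j : Fin q`). -/

section Bubbles

variable {S : Type*} [TopologicalSpace S] [ChartedSpace Plane S] [IsManifold (𝓡 2) ∞ S]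

/-- The set `I^j` (at stage `k`) of the indices of the bubbles contained in the bubble `j`. -/
def innerBubbles (h : ℕ → Metric S) {q : ℕ} (x : Fin q → ℕ → S) (ρ : Fin q → ℕ → ℝ) (k : ℕ)
    (j : Fin q) : Set (Fin q) :=
  {j' | x j' k ∈ gball (h k) (x j k) (ρ j k) ∧
    Tendsto (fun l => ρ j l / ρ j' l) atTop atTop}

/-- The outer neck region `Ω_k(α) = B_α(a) ∖ ⋃_j B_{ρ^j/α}(x^j)`. -/
def outerNeck (h : ℕ → Metric S) (a : S) {q : ℕ} (x : Fin q → ℕ → S) (ρ : Fin q → ℕ → ℝ) (α : ℝ)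
    (k : ℕ) : Set S :=
  gball (h k) a α \ ⋃ j, gball (h k) (x j k) (α⁻¹ * ρ j k)

/-- The inner neck region
`Ω_k^j(α) = ⋃_{j' ∈ I^j} (B_{αρ^j}(x^{j'}) ∖ ⋃_{j'' ∈ I^j} B_{ρ^{j''}/α}(x^{j''}))`. -/
def innerNeck (h : ℕ → Metric S) {q : ℕ} (x : Fin q → ℕ → S) (ρ : Fin q → ℕ → ℝ) (α : ℝ) (k : ℕ)
    (j : Fin q) : Set S :=
  ⋃ j' ∈ innerBubbles h x ρ k j, (gball (h k) (x j' k) (α * ρ j k) \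
    ⋃ j'' ∈ innerBubbles h x ρ k j, gball (h k) (x j'' k) (α⁻¹ * ρ j'' k))

/-- The whole neck region `Ω_k(α)`, the union over all concentration points `a i`. -/
def neckRegion (h : ℕ → Metric S) {n : ℕ} (a : Fin n → S) {Q : Fin n → ℕ}
    (x : ∀ i, Fin (Q i) → ℕ → S) (ρ : ∀ i, Fin (Q i) → ℕ → ℝ) (α : ℝ) (k : ℕ) : Set S :=
  ⋃ i, (outerNeck h (a i) (x i) (ρ i) α k ∪ ⋃ j, innerNeck h (x i) (ρ i) α k j)

/-- The bubble ball `B_{r}(x^j)` with the balls `B_{αρ^j}(x^{j'})`, `j' ∈ I^j`, removed. -/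
def bubbleRegion (h : ℕ → Metric S) {q : ℕ} (x : Fin q → ℕ → S) (ρ : Fin q → ℕ → ℝ) (α : ℝ)
    (k : ℕ) (j : Fin q) (r : ℝ) : Set S :=
  gball (h k) (x j k) r \ ⋃ j' ∈ innerBubbles h x ρ k j, gball (h k) (x j' k) (α * ρ j k)

/-- The concentration radius of level `ε` in the bubble `j` at stage `k`, where `μ` is the energy
measure; it is `∞` if there is no ball as required. -/
def concentrationRadius [MeasurableSpace S] (μ : Measure S) (ε : ℝ) (h : ℕ → Metric S) {q : ℕ}
    (x : Fin q → ℕ → S) (ρ : Fin q → ℕ → ℝ) (α : ℝ) (k : ℕ) (j : Fin q) : ℝ≥0∞ :=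
  sInf {s | ∃ r : ℝ, s = ENNReal.ofReal r ∧ 0 < r ∧ r < ρ j k ∧ ∃ y : S,
    gball (h k) y r ⊆ bubbleRegion h x ρ α k j (α⁻¹ * ρ j k) ∧
    μ (gball (h k) y r) = ENNReal.ofReal ε}

end Bubbles

end BubbleNeck

end

/-!
The decomposition is a concentration-compactness statement about the energy measures `μ k`. They
have bounded total mass and no atoms (`gaussEnergy_singleton`), and since `h k → hlim` the geodesic
distances are uniformly equivalent, so that the geodesic balls form a ball system
(`SmoothConverges.isBallSystem`).

Instead of extracting subsequences again and again, all limits are taken along one nonprincipal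
ultrafilter on `ℕ`. Every dichotomy between scales (`r / s → 0` or `s` is bounded by a multiple of
`r`) is then decided, and a single subsequence is extracted at the end
(`exists_strictMono_of_eventually`).

A bubble (`IsBubble`) at a point `a` is a sequence of balls shrinking to `a` together with cores of
energy at least `ε` that stay away from every point where energy `ε` concentrates at a smaller
scale. The cores of separated bubbles are eventually disjoint (`exists_cores_disjoint`), so there
are at most `Λ / ε` of them, and a maximal family exists at each point `a i`
(`exists_isMaximalFamily`). The radii are enlarged by constants so that the ball of a bubble
contains the centers of all bubbles at bounded distance on its scale.

Conversely, every concentration of energy `ε` is caused by a bubble of the family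
(`ConcentratesAt.exists_bubble`): an almost minimal ball of energy `ε`, found by point picking
(`IsBallSystem.exists_almost_minimal`), is a bubble, and by maximality it is comparable to one of
the family. This gives the lower bound on the concentration radius
(`IsMaximalFamily.exists_radius_lower_bound`).

For the neck estimate (`exists_neckSet_annulus_lt`), suppose that there are annuli of energy at
least `ε` in neck regions whose parameters `α` tend to zero. Around the center of a bubble much
smaller than the annulus, the neck region contains no ball of radius comparable to the annulus
(`false_of_bubble_ball_subset_neckSet`), so no energy concentrates on the annulus, and the annulus
is the core of a bubble. By maximality this bubble is comparable to one of the family; but a neck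
region contains no ball comparable in radius and distance to a bubble of the family
(`false_of_comparable_ball_subset_neckSet`). For the finitely many remaining indices `k` the whole
neck region has energy less than `ε` when `α` is small.
-/

namespace BubbleNeck

/-! ### Geodesic balls of a convergent sequence of metrics -/

section Geodesic

variable {S : Type*} [TopologicalSpace S] [ChartedSpace Plane S] [IsManifold (𝓡 2) ∞ S]

/-- The geodesic distance, with the speed of a path written in terms of the metric tensor. -/
theorem geodEDist_eq_iInf (h : Metric S) (x y : S) :
    geodEDist h x y = ⨅ (γ : Path x y) (_ : ContMDiff (𝓡∂ 1) (𝓡 2) 1 γ),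
      ∫⁻ t, ENNReal.ofReal (Real.sqrt (h.inner (γ t) (mfderiv (𝓡∂ 1) (𝓡 2) γ t 1)
        (mfderiv (𝓡∂ 1) (𝓡 2) γ t 1))) := by
  let _ : RiemannianBundle (fun x : S => TangentSpace (𝓡 2) x) := ⟨h.toRiemannianMetric⟩
  have key : ∀ (x : S) (v : TangentSpace (𝓡 2) x),
      ‖v‖ₑ = ENNReal.ofReal (Real.sqrt (h.inner x v v)) := by
    intro x v
    rw [← ofReal_norm, norm_eq_sqrt_real_inner]
    rfl
  rw [geodEDist, Manifold.riemannianEDist]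
  simp only [key]

theorem geodEDist_self (h : Metric S) (x : S) : geodEDist h x x = 0 := by
  let _ : RiemannianBundle (fun x : S => TangentSpace (𝓡 2) x) := ⟨h.toRiemannianMetric⟩
  exact Manifold.riemannianEDist_self

theorem geodEDist_comm (h : Metric S) (x y : S) : geodEDist h x y = geodEDist h y x := by
  let _ : RiemannianBundle (fun x : S => TangentSpace (𝓡 2) x) := ⟨h.toRiemannianMetric⟩
  exact Manifold.riemannianEDist_comm

theorem geodEDist_triangle (h : Metric S) (x y z : S) :
    geodEDist h x z ≤ geodEDist h x y + geodEDist h y z := by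
  let _ : RiemannianBundle (fun x : S => TangentSpace (𝓡 2) x) := ⟨h.toRiemannianMetric⟩
  have : IsManifold (𝓡 2) 1 S := .of_le (n := ∞) (by norm_cast)
  exact Manifold.riemannianEDist_triangle

theorem eventually_mem_gball (h : Metric S) (x : S) {r : ℝ} (hr : 0 < r) :
    ∀ᶠ y in 𝓝 x, y ∈ gball h x r := by
  let _ : RiemannianBundle (fun x : S => TangentSpace (𝓡 2) x) := ⟨h.toRiemannianMetric⟩
  have : IsManifold (𝓡 2) 1 S := .of_le (n := ∞) (by norm_cast)
  have : IsContinuousRiemannianBundle Plane (fun x : S => TangentSpace (𝓡 2) x) :=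
    ⟨⟨h.inner, h.contMDiff.continuous, fun b v w => rfl⟩⟩
  exact eventually_riemannianEDist_lt (𝓡 2) x (ENNReal.ofReal_pos.2 hr)

theorem exists_gball_subset [RegularSpace S] (h : Metric S) {x : S} {U : Set S} (hU : U ∈ 𝓝 x) :
    ∃ r : ℝ, 0 < r ∧ gball h x r ⊆ U := by
  let _ : RiemannianBundle (fun x : S => TangentSpace (𝓡 2) x) := ⟨h.toRiemannianMetric⟩
  have : IsManifold (𝓡 2) 1 S := .of_le (n := ∞) (by norm_cast)
  have : IsContinuousRiemannianBundle Plane (fun x : S => TangentSpace (𝓡 2) x) :=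
    ⟨⟨h.inner, h.contMDiff.continuous, fun b v w => rfl⟩⟩
  obtain ⟨c, hc, hcU⟩ := setOfPred_riemannianEDist_lt_subset_nhds (𝓡 2) hU
  refine ⟨c, hc, fun y hy => hcU ?_⟩
  simpa [gball, geodEDist] using hy

theorem geodEDist_le_mul {h h' : Metric S} {C : ℝ≥0} (hC0 : 0 < C)
    (hC : ∀ (x : S) (v : TangentSpace (𝓡 2) x), h.inner x v v ≤ (C : ℝ) ^ 2 * h'.inner x v v)
    (x y : S) : geodEDist h x y ≤ C * geodEDist h' x y := by
  have key : ∀ (x : S) (v : TangentSpace (𝓡 2) x),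
      ENNReal.ofReal (Real.sqrt (h.inner x v v)) ≤
        C * ENNReal.ofReal (Real.sqrt (h'.inner x v v)) := by
    intro x v
    rw [← ENNReal.ofReal_coe_nnreal (p := C), ← ENNReal.ofReal_mul (NNReal.coe_nonneg C)]
    refine ENNReal.ofReal_le_ofReal ((Real.sqrt_le_sqrt (hC x v)).trans_eq ?_)
    rw [Real.sqrt_mul (by positivity), Real.sqrt_sq (NNReal.coe_nonneg C)]
  have hC1 : (C : ℝ≥0∞) ≠ 0 := by simpa using hC0.ne'
  simp only [geodEDist_eq_iInf]
  rw [ENNReal.mul_iInf_of_ne hC1 ENNReal.coe_ne_top]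
  refine le_iInf fun γ => ?_
  rw [ENNReal.mul_iInf_of_ne hC1 ENNReal.coe_ne_top]
  refine le_iInf fun hγ => (iInf₂_le γ hγ).trans ?_
  rw [← lintegral_const_mul' _ _ ENNReal.coe_ne_top]
  exact lintegral_mono fun t => key _ _

/-- In a chart, `h(v, v)` is a quadratic polynomial in the coordinates of `v` with coefficients
`h_{ij}`. -/
theorem inner_mfderiv_symm (h : Metric S) (e : OpenPartialHomeomorph S Plane) (x w : Plane) :
    h.inner (e.symm x) (mfderiv (𝓡 2) (𝓡 2) e.symm x w) (mfderiv (𝓡 2) (𝓡 2) e.symm x w) =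
      ∑ i, ∑ j, w i * w j * metricCoef h e i j x := by
  have hw : w = w 0 • basisVec 0 + w 1 • basisVec 1 := by
    ext i
    fin_cases i <;> simp [basisVec]
  let D : Plane →L[ℝ] TangentSpace (𝓡 2) (e.symm x) := mfderiv (𝓡 2) (𝓡 2) e.symm x 
  have hDw : D w = w 0 • D (basisVec 0) + w 1 • D (basisVec 1) := by
    conv_lhs => rw [hw]
    rw [map_add, map_smul, map_smul]
  change h.inner (e.symm x) (D w) (D w) = _
  have hb : ∀ i j, h.inner (e.symm x) (D (basisVec i)) (D (basisVec j)) = metricCoef h e i j x :=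
    fun _ _ => rfl
  rw [hDw]
  simp only [Fin.sum_univ_two, map_add, map_smul, _root_.add_apply, _root_.smul_apply, smul_eq_mul,
    hb]
  ring

theorem mfderiv_symm_mfderiv_apply {e : OpenPartialHomeomorph S Plane}
    (he : e ∈ atlas Plane S) {x : Plane} (hx : x ∈ e.target)
    (v : TangentSpace (𝓡 2) (e.symm x)) :
    mfderiv (𝓡 2) (𝓡 2) e.symm x (mfderiv (𝓡 2) (𝓡 2) e (e.symm x) v) = v := by
  have : IsManifold (𝓡 2) 1 S := .of_le (n := ∞) (by norm_cast)
  have h1 := (mdifferentiable_of_mem_atlas (I := 𝓡 2) he).symm_comp_deriv (e.map_target hx)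
  have h2 := congrArg (fun L => L v) h1
  have h3 : ∀ q, q = x → (show Plane from mfderiv (𝓡 2) (𝓡 2) e.symm q
      (mfderiv (𝓡 2) (𝓡 2) e (e.symm x) v)) = (show Plane from mfderiv (𝓡 2) (𝓡 2) e.symm x
      (mfderiv (𝓡 2) (𝓡 2) e (e.symm x) v)) := by
    rintro q rfl; rfl
  exact (h3 _ (e.right_inv hx)).symm.trans h2

/-- The coordinates of a tangent vector at a point near `p` are controlled by its length. -/
theorem eventually_norm_mfderiv_chartAt_le (h : Metric S) (p : S) :
    ∃ C : ℝ, 0 < C ∧ ∀ᶠ y in 𝓝 p, ∀ v : TangentSpace (𝓡 2) y,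
      ‖(show Plane from mfderiv (𝓡 2) (𝓡 2) (chartAt Plane p) y v)‖ ^ 2 ≤ C * h.inner y v v := by
  let _ : RiemannianBundle (fun x : S => TangentSpace (𝓡 2) x) := ⟨h.toRiemannianMetric⟩
  have : IsManifold (𝓡 2) 1 S := .of_le (n := ∞) (by norm_cast)
  have : IsContinuousRiemannianBundle Plane (fun x : S => TangentSpace (𝓡 2) x) :=
    ⟨⟨h.inner, h.contMDiff.continuous, fun b v w => rfl⟩⟩
  obtain ⟨C, hC, hy⟩ := eventually_norm_trivializationAt_lt Plane
    (fun x : S => TangentSpace (𝓡 2) x) p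
  refine ⟨C ^ 2, by positivity, ?_⟩
  filter_upwards [hy, chart_source_mem_nhds Plane p] with y hy hys v
  rw [TangentBundle.continuousLinearMapAt_trivializationAt hys] at hy
  have h1 := ContinuousLinearMap.le_of_opNorm_le _ hy.le v
  have h2 : ‖v‖ ^ 2 = h.inner y v v := by
    rw [← real_inner_self_eq_norm_sq]; rfl
  rw [← h2, ← mul_pow]
  exact pow_le_pow_left₀ (norm_nonneg _) h1 2

/-- Near each point the quadratic forms of the metrics `h k` are eventually comparable to that of
the limit. -/
theorem SmoothConverges.eventually_nhds [T2Space S] [CompactSpace S] {h : ℕ → Metric S}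
    {hlim : Metric S} (hconv : SmoothConverges h hlim) (p : S) :
    ∃ V ∈ 𝓝 p, ∀ᶠ k in atTop, ∀ y ∈ V, ∀ v : TangentSpace (𝓡 2) y,
      |(h k).inner y v v - hlim.inner y v v| ≤ 1 / 2 * hlim.inner y v v := by
  obtain ⟨C, hC, hev⟩ := eventually_norm_mfderiv_chartAt_le hlim p
  set e := chartAt Plane p with he
  have hea : e ∈ atlas Plane S := chart_mem_atlas Plane p
  obtain ⟨V, hVp, hVsub, hVc⟩ := local_compact_nhds
    (hev.and (e.open_source.mem_nhds (mem_chart_source Plane p)))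
  refine ⟨V, hVp, ?_⟩
  have hKt : e '' V ⊆ e.target := by
    rintro _ ⟨y, hy, rfl⟩
    exact e.map_source (hVsub hy).2
  have hKc : IsCompact (e '' V) :=
    hVc.image_of_continuousOn (e.continuousOn.mono fun y hy => (hVsub hy).2)
  -- the coefficients converge uniformly with an error that is small relative to `C`
  set δ : ℝ := 1 / (4 * C) with hδ
  have hδ0 : 0 < δ := by positivity
  have hcoef : ∀ᶠ k in atTop, ∀ i j : Fin 2, ∀ x ∈ e '' V,
      |metricCoef (h k) e i j x - metricCoef hlim e i j x| < δ := by
    refine eventually_all.2 fun i => eventually_all.2 fun j => ?_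
    filter_upwards [Metric.tendstoUniformlyOn_iff.1 (hconv 0 e hea _ hKt hKc i j) δ hδ0]
      with k hk x hx
    have h1 := hk x hx
    rw [dist_comm, iteratedFDeriv_zero_eq_comp, iteratedFDeriv_zero_eq_comp] at h1
    rwa [Function.comp_apply, Function.comp_apply, LinearIsometryEquiv.dist_map,
      Real.dist_eq] at h1
  filter_upwards [hcoef] with k hk y hy v
  have hys := (hVsub hy).2
  have hvb := (hVsub hy).1 v
  have hky := fun i j => hk i j (e y) (mem_image_of_mem e hy)
  obtain ⟨x, hx, rfl⟩ : ∃ x ∈ e.target, e.symm x = y := ⟨e y, e.map_source hys, e.left_inv hys⟩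
  rw [e.right_inv hx] at hky
  set w : Plane := mfderiv (𝓡 2) (𝓡 2) e (e.symm x) v with hw
  have hv : mfderiv (𝓡 2) (𝓡 2) e.symm x w = v := mfderiv_symm_mfderiv_apply hea hx v
  have hwb : w 0 ^ 2 + w 1 ^ 2 ≤ C * hlim.inner (e.symm x) v v := by
    refine le_trans (le_of_eq ?_) hvb
    change _ = ‖w‖ ^ 2
    rw [EuclideanSpace.norm_sq_eq, Fin.sum_univ_two]
    simp
  have hq : |(h k).inner (e.symm x) v v - hlim.inner (e.symm x) v v| ≤
      δ * (|w 0| + |w 1|) ^ 2 := by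
    rw [← hv, inner_mfderiv_symm, inner_mfderiv_symm]
    have hterm : ∀ i j : Fin 2, |w i * w j * (metricCoef (h k) e i j x - metricCoef hlim e i j x)| ≤
        |w i| * |w j| * δ := fun i j => by
      rw [abs_mul, abs_mul]
      exact mul_le_mul_of_nonneg_left (hky i j).le (by positivity)
    simp only [Fin.sum_univ_two]
    have := hterm 0 0
    have := hterm 0 1
    have := hterm 1 0
    have := hterm 1 1
    simp only [abs_le] at *
    constructor <;> nlinarith
  refine hq.trans ?_
  have h2 : (|w 0| + |w 1|) ^ 2 ≤ 2 * (w 0 ^ 2 + w 1 ^ 2) := by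
    nlinarith [sq_nonneg (|w 0| - |w 1|), sq_abs (w 0), sq_abs (w 1)]
  calc δ * (|w 0| + |w 1|) ^ 2 ≤ δ * (2 * (C * hlim.inner (e.symm x) v v)) := by gcongr; linarith
    _ = 1 / 2 * hlim.inner (e.symm x) v v := by rw [hδ]; field_simp; ring

/-- The geodesic distances of a convergent sequence of metrics are eventually uniformly equivalent
to that of the limit. -/
theorem SmoothConverges.eventually_geodEDist_le [T2Space S] [CompactSpace S] {h : ℕ → Metric S}
    {hlim : Metric S} (hconv : SmoothConverges h hlim) :
    ∀ᶠ k in atTop, ∀ x y : S, geodEDist (h k) x y ≤ 2 * geodEDist hlim x y ∧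
      geodEDist hlim x y ≤ 2 * geodEDist (h k) x y := by
  choose V hV hVk using hconv.eventually_nhds
  obtain ⟨t, ht⟩ := CompactSpace.elim_nhds_subcover V hV
  filter_upwards [(eventually_all_finset t).2 fun p _ => hVk p] with k hk x y
  have hcomp : ∀ (z : S) (v : TangentSpace (𝓡 2) z),
      |(h k).inner z v v - hlim.inner z v v| ≤ 1 / 2 * hlim.inner z v v := fun z v => by
    have hz : z ∈ ⋃ p ∈ t, V p := ht.symm ▸ mem_univ z
    obtain ⟨p, hp, hzp⟩ := mem_iUnion₂.1 hz
    exact hk p hp z hzp v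
  constructor
  · refine geodEDist_le_mul (C := 2) (by norm_num) (fun z v => ?_) x y
    have h1 := hcomp z v
    have h2 := (abs_nonneg _).trans h1
    have h3 := abs_le.1 h1
    push_cast
    linarith
  · refine geodEDist_le_mul (C := 2) (by norm_num) (fun z v => ?_) x y
    have h1 := hcomp z v
    have h2 := (abs_nonneg _).trans h1
    have h3 := abs_le.1 h1
    push_cast
    linarith

end Geodesic

/-- A sequence of families of open balls on a fixed space: each family behaves like the balls of an
extended metric inducing the topology, and near each point the families are asymptotically
uniformly equivalent to the topology. -/
structure IsBallSystem {S : Type*} [TopologicalSpace S] (B : ℕ → S → ℝ → Set S) : Prop where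
  mem_self : ∀ k x {r : ℝ}, 0 < r → x ∈ B k x r
  pos : ∀ {k x y} {r : ℝ}, y ∈ B k x r → 0 < r
  symm : ∀ {k x y} {r : ℝ}, y ∈ B k x r → x ∈ B k y r
  trans : ∀ {k x y z} {r s : ℝ}, y ∈ B k x r → z ∈ B k y s → z ∈ B k x (r + s)
  mono : ∀ {k x} {r s : ℝ}, r ≤ s → B k x r ⊆ B k x s
  isOpen : ∀ k x (r : ℝ), IsOpen (B k x r)
  exists_subset : ∀ k {x U}, U ∈ 𝓝 x → ∃ r : ℝ, 0 < r ∧ B k x r ⊆ U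
  exists_eventually_subset : ∀ {x U}, U ∈ 𝓝 x → ∃ r : ℝ, 0 < r ∧ ∀ᶠ k in atTop, B k x r ⊆ U
  eventually_mem : ∀ x {r : ℝ}, 0 < r → ∀ᶠ y in 𝓝 x, ∀ᶠ k in atTop, y ∈ B k x r

section

variable {S : Type*} [TopologicalSpace S] [ChartedSpace Plane S]

theorem mem_gball_symm [IsManifold (𝓡 2) ∞ S] {h : Metric S} {x y : S} {r : ℝ}
    (hy : y ∈ gball h x r) : x ∈ gball h y r := by
  rw [gball, mem_ofPred_eq] at hy ⊢
  rwa [geodEDist_comm]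

theorem mem_gball_trans [IsManifold (𝓡 2) ∞ S] {h : Metric S} {x y z : S} {r s : ℝ}
    (hy : y ∈ gball h x r) (hz : z ∈ gball h y s) : z ∈ gball h x (r + s) := by
  rw [gball, mem_ofPred_eq] at hy hz ⊢
  have hr : 0 < r := ENNReal.ofReal_pos.1 (bot_le.trans_lt hy)
  have hs : 0 < s := ENNReal.ofReal_pos.1 (bot_le.trans_lt hz)
  rw [ENNReal.ofReal_add hr.le hs.le]
  exact (geodEDist_triangle h x y z).trans_lt (ENNReal.add_lt_add hy hz)

theorem gball_mono [IsManifold (𝓡 2) ∞ S] {h : Metric S} {x : S} {r s : ℝ} (hrs : r ≤ s) :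
    gball h x r ⊆ gball h x s :=
  fun _ hy => lt_of_lt_of_le hy (ENNReal.ofReal_le_ofReal hrs)

theorem isOpen_gball [IsManifold (𝓡 2) ∞ S] (h : Metric S) (x : S) (r : ℝ) :
    IsOpen (gball h x r) := by
  refine isOpen_iff_mem_nhds.2 fun y hy => ?_
  have hy' : geodEDist h x y < ENNReal.ofReal r := hy
  obtain ⟨s, hs, hys⟩ := ENNReal.lt_iff_exists_real_btwn.1 hy'
  have hsr : s < r := (ENNReal.ofReal_lt_ofReal_iff_of_nonneg hs).1 hys.2
  have hy2 : y ∈ gball h x s := hys.1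
  filter_upwards [eventually_mem_gball h y (sub_pos.2 hsr)] with z hz
  have := mem_gball_trans hy2 hz
  rwa [add_sub_cancel] at this

/-- The geodesic balls of a convergent sequence of metrics on a closed surface form a ball
system. -/
theorem SmoothConverges.isBallSystem [IsManifold (𝓡 2) ∞ S] [T2Space S] [CompactSpace S]
    {h : ℕ → Metric S} {hlim : Metric S} (hconv : SmoothConverges h hlim) :
    IsBallSystem fun k => gball (h k) where
  mem_self k x r hr := by
    change geodEDist (h k) x x < _
    rw [geodEDist_self]
    exact ENNReal.ofReal_pos.2 hr
  pos hy := ENNReal.ofReal_pos.1 (bot_le.trans_lt hy)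
  symm := mem_gball_symm
  trans := mem_gball_trans
  mono := gball_mono
  isOpen k := isOpen_gball (h k)
  exists_subset k _ _ hU := exists_gball_subset (h k) hU
  exists_eventually_subset {x U} hU := by
    obtain ⟨r, hr, hrU⟩ := exists_gball_subset hlim hU
    refine ⟨r / 2, half_pos hr, ?_⟩
    filter_upwards [hconv.eventually_geodEDist_le] with k hk y hy
    refine hrU ((hk x y).2.trans_lt ?_)
    have hy' : geodEDist (h k) x y < ENNReal.ofReal (r / 2) := hy
    calc 2 * geodEDist (h k) x y < 2 * ENNReal.ofReal (r / 2) := by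
          rwa [ENNReal.mul_lt_mul_iff_right (by simp) (by simp)]
      _ = ENNReal.ofReal r := by
          rw [← ENNReal.ofReal_ofNat 2, ← ENNReal.ofReal_mul (by norm_num), mul_div_cancel₀]
          norm_num
  eventually_mem x r hr := by
    filter_upwards [eventually_mem_gball hlim x (half_pos hr)] with y hy
    filter_upwards [hconv.eventually_geodEDist_le] with k hk
    refine (hk x y).1.trans_lt ?_
    have hy' : geodEDist hlim x y < ENNReal.ofReal (r / 2) := hy
    calc 2 * geodEDist hlim x y < 2 * ENNReal.ofReal (r / 2) := by
          rwa [ENNReal.mul_lt_mul_iff_right (by simp) (by simp)]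
      _ = ENNReal.ofReal r := by
          rw [← ENNReal.ofReal_ofNat 2, ← ENNReal.ofReal_mul (by norm_num), mul_div_cancel₀]
          norm_num

end

theorem punctured_nhds_neBot {S : Type*} [TopologicalSpace S] [ChartedSpace Plane S] (p : S) :
    (𝓝[≠] p).NeBot := by
  rw [neBot_iff]
  intro h
  have hopen : IsOpen ({p} : Set S) := (isOpen_singleton_iff_punctured_nhds _).2 h
  have himg := (chartAt Plane p).isOpen_image_of_subset_source hopen
    (singleton_subset_iff.2 (mem_chart_source Plane p))
  rw [image_singleton] at himg
  exact NeBot.ne inferInstance ((isOpen_singleton_iff_punctured_nhds _).1 himg)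

/-! ### The energy measure has no atoms -/

theorem chartEnergy_singleton {S : Type*} [TopologicalSpace S] [T2Space S] [MeasurableSpace S]
    [BorelSpace S] {m : ℕ}
    (ξ : S → EuclideanSpace ℝ (Fin m)) (e : OpenPartialHomeomorph S Plane) (p : S) :
    chartEnergy ξ e {p} = 0 := by
  rw [chartEnergy]
  by_cases hm : AEMeasurable e.symm ((volume.restrict e.target).withDensity fun x =>
    ENNReal.ofReal (gaussEnergyDensity e.target (ξ ∘ e.symm) x))
  · rw [Measure.map_apply_of_aemeasurable hm (measurableSet_singleton p)]
    refine withDensity_absolutelyContinuous _ _ ?_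
    rw [Measure.restrict_apply' e.open_target.measurableSet]
    refine Set.Subsingleton.measure_zero (fun x hx y hy => ?_) _
    exact e.symm.injOn hx.2 hy.2 (hx.1.trans hy.1.symm)
  · rw [Measure.map_of_not_aemeasurable hm, Measure.coe_zero, Pi.zero_apply]

/-- The energy has no atoms: removing an atom from a supremum of atomless measures leaves an upper
bound. -/
theorem gaussEnergy_singleton {S : Type*} [TopologicalSpace S] [ChartedSpace Plane S] [T2Space S]
    [MeasurableSpace S] [BorelSpace S] {m : ℕ}
    (ξ : S → EuclideanSpace ℝ (Fin m)) (p : S) : gaussEnergy ξ {p} = 0 := by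
  have hp : MeasurableSet ({p} : Set S) := measurableSet_singleton p
  have hle : gaussEnergy ξ ≤ (gaussEnergy ξ).restrict {p}ᶜ := by
    refine iSup₂_le fun e he => Measure.le_iff.2 fun A hA => ?_
    rw [Measure.restrict_apply hA]
    have h1 : chartEnergy ξ e A ≤ chartEnergy ξ e (A ∩ {p}ᶜ) := by
      refine (measure_mono (t := (A ∩ {p}ᶜ) ∪ {p}) fun x hx => ?_).trans
        ((measure_union_le _ _).trans_eq ?_)
      · by_cases hxp : x = p
        · exact Or.inr hxp
        · exact Or.inl ⟨hx, hxp⟩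
      · rw [chartEnergy_singleton, add_zero]
    exact h1.trans ((le_iSup₂_of_le (f := fun e _ => chartEnergy ξ e) e he le_rfl :
      chartEnergy ξ e ≤ gaussEnergy ξ) _)
  have h2 := hle {p}
  rw [Measure.restrict_apply hp, inter_compl_self, measure_empty] at h2
  exact nonpos_iff_eq_zero.1 h2

/-! ### Atomless measures on balls -/

section BallMeasure

variable {S : Type*} [TopologicalSpace S] {B : ℕ → S → ℝ → Set S}

theorem IsBallSystem.exists_measure_lt [T1Space S] [MeasurableSpace S] [BorelSpace S]
    (hB : IsBallSystem B) (k : ℕ) (ν : Measure S) [IsFiniteMeasure ν] (p : S) (hp : ν {p} = 0)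
    {η : ℝ≥0∞} (hη : 0 < η) : ∃ r : ℝ, 0 < r ∧ ν (B k p r) < η := by
  have hanti : Antitone fun n : ℕ => B k p (1 / ((n : ℝ) + 1)) := fun m n hmn =>
    hB.mono (one_div_le_one_div_of_le (by positivity) (by gcongr))
  have hinter : ⋂ n : ℕ, B k p (1 / ((n : ℝ) + 1)) = {p} := by
    refine Subset.antisymm (fun y hy => ?_) ?_
    · by_contra hyp
      obtain ⟨r, hr, hrU⟩ := hB.exists_subset k (isOpen_compl_singleton.mem_nhds
        (fun h => hyp h.symm : p ∈ ({y}ᶜ : Set S)))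
      obtain ⟨n, hn⟩ := exists_nat_one_div_lt hr
      exact hrU (hB.mono hn.le (mem_iInter.1 hy n)) rfl
    · rintro y rfl
      exact mem_iInter.2 fun n => hB.mem_self k y (by positivity)
  have hlim := tendsto_measure_iInter_atTop (μ := ν)
    (fun n : ℕ => (hB.isOpen k p (1 / ((n : ℝ) + 1))).measurableSet.nullMeasurableSet) hanti
    ⟨0, measure_ne_top _ _⟩
  rw [hinter, hp] at hlim
  obtain ⟨n, hn⟩ := (hlim.eventually (gt_mem_nhds hη)).exists
  exact ⟨1 / ((n : ℝ) + 1), by positivity, hn⟩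

/-- On a compact space an atomless finite measure is uniformly small on small balls. -/
theorem IsBallSystem.exists_forall_measure_lt [T1Space S] [CompactSpace S] [MeasurableSpace S]
    [BorelSpace S] (hB : IsBallSystem B) (k : ℕ) (ν : Measure S) [IsFiniteMeasure ν]
    (hν : ∀ p, ν {p} = 0) {η : ℝ≥0∞} (hη : 0 < η) :
    ∃ r : ℝ, 0 < r ∧ ∀ y, ν (B k y r) < η := by
  choose R hR hRη using fun p => hB.exists_measure_lt k ν p (hν p) hη
  obtain ⟨t, ht⟩ := CompactSpace.elim_nhds_subcover (fun p => B k p (R p / 2))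
    fun p => (hB.isOpen k p _).mem_nhds (hB.mem_self k p (half_pos (hR p)))
  have hfin : ∃ r : ℝ, 0 < r ∧ ∀ p ∈ t, r ≤ R p / 2 := by
    rcases t.eq_empty_or_nonempty with rfl | hne
    · exact ⟨1, one_pos, by simp⟩
    · refine ⟨t.inf' hne fun p => R p / 2, ?_, fun p hp => Finset.inf'_le _ hp⟩
      exact (Finset.lt_inf'_iff hne).2 fun p _ => half_pos (hR p)
  obtain ⟨r, hr, hrt⟩ := hfin
  refine ⟨r, hr, fun y => ?_⟩
  have hy : y ∈ ⋃ p ∈ t, B k p (R p / 2) := ht.symm ▸ mem_univ y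
  obtain ⟨p, hp, hyp⟩ := mem_iUnion₂.1 hy
  refine (measure_mono fun z hz => ?_).trans_lt (hRη p)
  have := hB.trans hyp hz
  exact hB.mono (by linarith [hrt p hp]) this

/-- Point picking: inside a slightly larger ball, a ball of measure at least `ε` contains one that
is almost minimal, up to a factor `2`, among the balls of measure at least `ε` with nearby
centers. Passing to a competitor of at most half the radius moves the center by a controlled amount
and can be repeated only finitely often, since very small balls have measure less than `ε`. -/
theorem IsBallSystem.exists_almost_minimal (hB : IsBallSystem B) [MeasurableSpace S] (k : ℕ)
    (ν : Measure S) {ε : ℝ≥0∞} {r₀ : ℝ} (hr₀ : 0 < r₀) (hν : ∀ y, ν (B k y r₀) < ε) {δ : ℝ}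
    (hδ : 0 < δ) {p : S} {t : ℝ} (ht : 0 < t) (hp : ε ≤ ν (B k p t)) :
    ∃ (y : S) (r : ℝ), 0 < r ∧ r ≤ t ∧ y ∈ B k p (t / δ) ∧ ε ≤ ν (B k y r) ∧
      ∀ q ∈ B k y (r / (2 * δ)), ∀ r' ≤ r / 2, ν (B k q r') < ε := by
  obtain ⟨n, hn⟩ : ∃ n : ℕ, t < r₀ * 2 ^ n := by
    obtain ⟨n, hn⟩ := pow_unbounded_of_one_lt (t / r₀) one_lt_two
    exact ⟨n, by rwa [div_lt_iff₀' hr₀] at hn⟩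
  induction n generalizing p t with
  | zero =>
    rw [pow_zero, mul_one] at hn
    exact absurd (hp.trans (measure_mono (hB.mono hn.le))) (hν p).not_ge
  | succ n ih =>
    by_cases hgood : ∀ q ∈ B k p (t / (2 * δ)), ∀ r' ≤ t / 2, ν (B k q r') < ε
    · exact ⟨p, t, ht, le_rfl, hB.mem_self k p (by positivity), hp, hgood⟩
    · push Not at hgood
      obtain ⟨q, hq, r', hr', hqr'⟩ := hgood
      have hr'0 : 0 < r' := by
        by_contra h0
        have : B k q r' = ∅ := eq_empty_of_forall_notMem fun z hz => h0 (hB.pos hz)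
        rw [this, measure_empty] at hqr'
        exact (hqr'.trans_lt' (hν q)).not_ge bot_le
      obtain ⟨y, r, hr, hrr', hy, hyr, hmin⟩ := ih hr'0 hqr' (by rw [pow_succ] at hn; linarith)
      refine ⟨y, r, hr, by linarith, hB.mono ?_ (hB.trans hq hy), hyr, hmin⟩
      have h1 : r' / δ ≤ t / 2 / δ := by gcongr
      have h2 : t / (2 * δ) + t / 2 / δ = t / δ := by field_simp; ring
      linarith

end BallMeasure

/-! ### Comparison of scales along an ultrafilter -/

section Scales

variable (𝒰 : Ultrafilter ℕ)

/-- The scale `r` is negligible compared to `s`: `r / s → 0` along the ultrafilter. -/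
def ScaleLT (r s : ℕ → ℝ) : Prop := ∀ c : ℝ, 0 < c → ∀ᶠ k in (𝒰 : Filter ℕ), r k < c * s k

/-- The scale `r` is bounded by a multiple of `s` along the ultrafilter. -/
def ScaleLE (r s : ℕ → ℝ) : Prop := ∃ C : ℝ, 0 < C ∧ ∀ᶠ k in (𝒰 : Filter ℕ), r k ≤ C * s k

variable {𝒰} {r s t : ℕ → ℝ}

theorem scaleLE_of_not_scaleLT (h : ¬ ScaleLT 𝒰 r s) : ScaleLE 𝒰 s r := by
  simp only [ScaleLT, not_forall] at h
  obtain ⟨c, hc, h⟩ := h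
  refine ⟨c⁻¹, inv_pos.2 hc, ?_⟩
  filter_upwards [Ultrafilter.eventually_not.2 h] with k hk
  rw [inv_mul_eq_div, le_div_iff₀' hc]
  exact not_lt.1 hk

theorem ScaleLT.le (h : ScaleLT 𝒰 r s) : ScaleLE 𝒰 r s :=
  ⟨1, one_pos, (h 1 one_pos).mono fun _ hk => hk.le⟩

theorem ScaleLE.refl (r : ℕ → ℝ) : ScaleLE 𝒰 r r :=
  ⟨1, one_pos, Eventually.of_forall fun k => (one_mul (r k)).ge⟩

theorem ScaleLE.trans (h : ScaleLE 𝒰 r s) (h' : ScaleLE 𝒰 s t) : ScaleLE 𝒰 r t := by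
  obtain ⟨C, hC, h⟩ := h
  obtain ⟨D, hD, h'⟩ := h'
  refine ⟨C * D, by positivity, ?_⟩
  filter_upwards [h, h'] with k hk hk'
  calc r k ≤ C * s k := hk
    _ ≤ C * (D * t k) := by gcongr
    _ = C * D * t k := by ring

theorem ScaleLT.trans_le (h : ScaleLT 𝒰 r s) (h' : ScaleLE 𝒰 s t) : ScaleLT 𝒰 r t := by
  obtain ⟨D, hD, h'⟩ := h'
  intro c hc
  filter_upwards [h (c / D) (by positivity), h'] with k hk hk'
  calc r k < c / D * s k := hk
    _ ≤ c / D * (D * t k) := by gcongr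
    _ = c * t k := by field_simp

theorem ScaleLE.trans_lt (h : ScaleLE 𝒰 r s) (h' : ScaleLT 𝒰 s t) : ScaleLT 𝒰 r t := by
  obtain ⟨D, hD, h⟩ := h
  intro c hc
  filter_upwards [h' (c / D) (by positivity), h] with k hk hk'
  calc r k ≤ D * s k := hk'
    _ < D * (c / D * t k) := by gcongr
    _ = c * t k := by field_simp

theorem ScaleLT.trans (h : ScaleLT 𝒰 r s) (h' : ScaleLT 𝒰 s t) : ScaleLT 𝒰 r t :=
  h.trans_le h'.le

theorem ScaleLT.not_le (h : ScaleLT 𝒰 r s) : ¬ ScaleLE 𝒰 s r := by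
  intro h'
  obtain ⟨k, hk⟩ := ((h'.trans_lt h) 1 one_pos).exists
  linarith

theorem ScaleLT.irrefl : ¬ ScaleLT 𝒰 s s :=
  fun h => h.not_le (ScaleLE.refl s)

theorem ScaleLE.const_mul_left {C : ℝ} (hC : 0 < C) (r : ℕ → ℝ) :
    ScaleLE 𝒰 (fun k => C * r k) r :=
  ⟨C, hC, Eventually.of_forall fun _ => le_rfl⟩

theorem ScaleLE.const_mul_right {C : ℝ} (hC : 0 < C) (r : ℕ → ℝ) :
    ScaleLE 𝒰 r (fun k => C * r k) :=
  ⟨C⁻¹, inv_pos.2 hC, Eventually.of_forall fun k => by rw [inv_mul_cancel_left₀ hC.ne']⟩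

variable {S : Type*} (B : ℕ → S → ℝ → Set S)

variable (𝒰) in
/-- The distance of `y` from `x` is bounded by a multiple of the scale `s`. -/
def WithinScale (x y : ℕ → S) (s : ℕ → ℝ) : Prop :=
  ∃ C : ℝ, 0 < C ∧ ∀ᶠ k in (𝒰 : Filter ℕ), y k ∈ B k (x k) (C * s k)

variable (𝒰) in
/-- The distance of `y` from `x` is negligible compared to the scale `s`. -/
def CloseAtScale (x y : ℕ → S) (s : ℕ → ℝ) : Prop :=
  ∀ c : ℝ, 0 < c → ∀ᶠ k in (𝒰 : Filter ℕ), y k ∈ B k (x k) (c * s k)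

variable {B} {x y z : ℕ → S}

theorem CloseAtScale.within (h : CloseAtScale 𝒰 B x y s) : WithinScale 𝒰 B x y s :=
  ⟨1, one_pos, h 1 one_pos⟩

theorem eventually_notMem_of_not_within (h : ¬ WithinScale 𝒰 B x y s) {C : ℝ} (hC : 0 < C) :
    ∀ᶠ k in (𝒰 : Filter ℕ), y k ∉ B k (x k) (C * s k) :=
  Ultrafilter.eventually_not.2 fun h' => h ⟨C, hC, h'⟩

variable [TopologicalSpace S]

theorem WithinScale.symm (hB : IsBallSystem B) (h : WithinScale 𝒰 B x y s) :
    WithinScale 𝒰 B y x s := by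
  obtain ⟨C, hC, h⟩ := h
  exact ⟨C, hC, h.mono fun _ hk => hB.symm hk⟩

theorem CloseAtScale.symm (hB : IsBallSystem B) (h : CloseAtScale 𝒰 B x y s) :
    CloseAtScale 𝒰 B y x s :=
  fun c hc => (h c hc).mono fun _ hk => hB.symm hk

theorem WithinScale.trans (hB : IsBallSystem B) (h : WithinScale 𝒰 B x y s)
    (h' : WithinScale 𝒰 B y z s) : WithinScale 𝒰 B x z s := by
  obtain ⟨C, hC, h⟩ := h
  obtain ⟨D, hD, h'⟩ := h'
  refine ⟨C + D, by positivity, ?_⟩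
  filter_upwards [h, h'] with k hk hk'
  rw [add_mul]
  exact hB.trans hk hk'

theorem CloseAtScale.trans (hB : IsBallSystem B) (h : CloseAtScale 𝒰 B x y s)
    (h' : CloseAtScale 𝒰 B y z s) : CloseAtScale 𝒰 B x z s := by
  intro c hc
  filter_upwards [h (c / 2) (by positivity), h' (c / 2) (by positivity)] with k hk hk'
  have := hB.trans hk hk'
  rwa [← add_mul, add_halves] at this

theorem WithinScale.mono (hB : IsBallSystem B) (h : WithinScale 𝒰 B x y s) (hst : ScaleLE 𝒰 s t) :
    WithinScale 𝒰 B x y t := by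
  obtain ⟨C, hC, h⟩ := h
  obtain ⟨D, hD, h'⟩ := hst
  refine ⟨C * D, by positivity, ?_⟩
  filter_upwards [h, h'] with k hk hk'
  refine hB.mono ?_ hk
  calc C * s k ≤ C * (D * t k) := by gcongr
    _ = C * D * t k := by ring

theorem WithinScale.close (hB : IsBallSystem B) (h : WithinScale 𝒰 B x y s)
    (hst : ScaleLT 𝒰 s t) : CloseAtScale 𝒰 B x y t := by
  obtain ⟨C, hC, h⟩ := h
  intro c hc
  filter_upwards [h, hst (c / C) (by positivity)] with k hk hk'
  refine hB.mono ?_ hk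
  calc C * s k ≤ C * (c / C * t k) := by gcongr
    _ = c * t k := by field_simp

theorem CloseAtScale.mono (hB : IsBallSystem B) (h : CloseAtScale 𝒰 B x y s)
    (hst : ScaleLE 𝒰 s t) : CloseAtScale 𝒰 B x y t := by
  obtain ⟨D, hD, h'⟩ := hst
  intro c hc
  filter_upwards [h (c / D) (by positivity), h'] with k hk hk'
  refine hB.mono ?_ hk
  calc c / D * s k ≤ c / D * (D * t k) := by gcongr
    _ = c * t k := by field_simp

theorem WithinScale.refl (hB : IsBallSystem B) (x : ℕ → S) (hs : ∀ k, 0 < s k) :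
    WithinScale 𝒰 B x x s :=
  ⟨1, one_pos, Eventually.of_forall fun k => hB.mem_self k _ (by simpa using hs k)⟩

/-- Two fixed points whose distance tends to zero coincide. -/
theorem CloseAtScale.eq_of_const [T1Space S] (hB : IsBallSystem B) (h𝒰 : (𝒰 : Filter ℕ) ≤ atTop)
    {p q : S} (h : CloseAtScale 𝒰 B (fun _ => p) (fun _ => q) fun _ => 1) : p = q := by
  by_contra hpq
  obtain ⟨r, hr, hrU⟩ := hB.exists_eventually_subset (isOpen_compl_singleton.mem_nhds
    (hpq : p ∈ ({q}ᶜ : Set S)))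
  obtain ⟨k, hk, hk'⟩ := ((h r hr).and (h𝒰 hrU)).exists
  rw [mul_one] at hk
  exact hk' hk rfl

/-- Diagonal choice: a countable family of properties that hold eventually along the ultrafilter
holds with an index tending to infinity. -/
theorem exists_tendsto_diagonal (h𝒰 : (𝒰 : Filter ℕ) ≤ atTop) {P : ℕ → ℕ → Prop}
    (h : ∀ N, ∀ᶠ k in (𝒰 : Filter ℕ), P N k) :
    ∃ M : ℕ → ℕ, Tendsto M 𝒰 atTop ∧ ∀ᶠ k in (𝒰 : Filter ℕ), P (M k) k := by
  classical
  refine ⟨fun k => Nat.findGreatest (fun N => P N k) k, tendsto_atTop.2 fun N => ?_, ?_⟩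
  · filter_upwards [h N, h𝒰 (eventually_ge_atTop N)] with k hk hNk
    exact Nat.le_findGreatest hNk hk
  · filter_upwards [h 0] with k hk
    exact Nat.findGreatest_spec (P := fun N => P N k) (Nat.zero_le k) hk

end Scales

/-! ### Separation of balls -/

section Separation

variable {S : Type*} [TopologicalSpace S] {𝒰 : Ultrafilter ℕ} {B : ℕ → S → ℝ → Set S} {x x' : ℕ → S}
  {ρ ρ' : ℕ → ℝ}

/-- Two sequences of balls are separated if their scales are different or their distance is large
compared to both radii. -/
def Separated {S : Type*} (𝒰 : Ultrafilter ℕ) (B : ℕ → S → ℝ → Set S) (x : ℕ → S) (ρ : ℕ → ℝ)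
    (x' : ℕ → S) (ρ' : ℕ → ℝ) : Prop :=
  ScaleLT 𝒰 ρ ρ' ∨ ScaleLT 𝒰 ρ' ρ ∨ ¬ WithinScale 𝒰 B x x' fun k => ρ k + ρ' k

theorem Separated.symm (hB : IsBallSystem B) (h : Separated 𝒰 B x ρ x' ρ') :
    Separated 𝒰 B x' ρ' x ρ := by
  rcases h with h | h | h
  · exact Or.inr (Or.inl h)
  · exact Or.inl h
  · refine Or.inr (Or.inr fun h' => h ?_)
    simpa only [add_comm] using h'.symm hB

theorem Separated.of_le (hB : IsBallSystem B) (h : Separated 𝒰 B x ρ x' ρ') {σ σ' : ℕ → ℝ}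
    (h1 : ScaleLE 𝒰 ρ σ) (h2 : ScaleLE 𝒰 σ ρ) (h1' : ScaleLE 𝒰 ρ' σ') (h2' : ScaleLE 𝒰 σ' ρ')
    (hρ : ∀ k, 0 < ρ k) (hρ' : ∀ k, 0 < ρ' k) :
    Separated 𝒰 B x σ x' σ' := by
  rcases h with h | h | h
  · exact Or.inl (h2.trans_lt (h.trans_le h1'))
  · exact Or.inr (Or.inl (h2'.trans_lt (h.trans_le h1)))
  · refine Or.inr (Or.inr fun h' => h (h'.mono hB ?_))
    obtain ⟨C, hC, hle⟩ := h2
    obtain ⟨C', hC', hle'⟩ := h2'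
    refine ⟨C + C', by positivity, ?_⟩
    filter_upwards [hle, hle'] with k hk hk'
    nlinarith [mul_pos hC (hρ' k), mul_pos hC' (hρ k)]

/-- The negation of separation: comparable radii and a distance bounded by their multiple. -/
theorem comparable_of_not_separated (hB : IsBallSystem B) (h : ¬ Separated 𝒰 B x ρ x' ρ') :
    ScaleLE 𝒰 ρ ρ' ∧ ScaleLE 𝒰 ρ' ρ ∧ WithinScale 𝒰 B x x' ρ := by
  simp only [Separated, not_or, not_not] at h
  have h1 := scaleLE_of_not_scaleLT h.1
  have h2 := scaleLE_of_not_scaleLT h.2.1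
  refine ⟨h2, h1, h.2.2.mono hB ?_⟩
  obtain ⟨C, hC, hle⟩ := h1
  refine ⟨1 + C, by positivity, hle.mono fun k hk => ?_⟩
  linarith

end Separation

/-! ### Concentration and bubbles -/

section Bubble

variable {S : Type*} [MeasurableSpace S]

/-- The measures concentrate at the points `p k` on a scale smaller than `s`: every ball around
`p k` of radius a fixed multiple of `s k` eventually has measure at least `ε`. -/
def ConcentratesAt (𝒰 : Ultrafilter ℕ) (B : ℕ → S → ℝ → Set S) (μ : ℕ → Measure S) (ε : ℝ≥0∞)
    (p : ℕ → S) (s : ℕ → ℝ) : Prop :=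
  ∀ c : ℝ, 0 < c → ∀ᶠ k in (𝒰 : Filter ℕ), ε ≤ μ k (B k (p k) (c * s k))

/-- A bubble at the point `a`: balls of center `x k → a` and radius `ρ k → 0` containing sets of
measure at least `ε`, the core, that stay away, at the scale `ρ`, from all points where the measures
concentrate on a scale smaller than `ρ`. -/
structure IsBubble (𝒰 : Ultrafilter ℕ) (B : ℕ → S → ℝ → Set S) (μ : ℕ → Measure S) (ε : ℝ≥0∞)
    (a : S) (x : ℕ → S) (ρ : ℕ → ℝ) : Prop where
  pos : ∀ k, 0 < ρ k
  center : CloseAtScale 𝒰 B (fun _ => a) x fun _ => 1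
  radius : ScaleLT 𝒰 ρ fun _ => 1
  core : ∃ A : ℕ → Set S, (∀ k, MeasurableSet (A k)) ∧ (∀ k, A k ⊆ B k (x k) (ρ k)) ∧
    (∀ᶠ k in (𝒰 : Filter ℕ), ε ≤ μ k (A k)) ∧ ∀ q, ConcentratesAt 𝒰 B μ ε q ρ →
      ∃ α : ℝ, 0 < α ∧ ∀ᶠ k in (𝒰 : Filter ℕ), Disjoint (A k) (B k (q k) (α * ρ k))

variable {𝒰 : Ultrafilter ℕ} {B : ℕ → S → ℝ → Set S} {μ : ℕ → Measure S}
  {ε : ℝ≥0∞} {a : S} {x p q : ℕ → S} {ρ s t : ℕ → ℝ}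

theorem IsBubble.eventually_le (hx : IsBubble 𝒰 B μ ε a x ρ) :
    ∀ᶠ k in (𝒰 : Filter ℕ), ε ≤ μ k (B k (x k) (ρ k)) := by
  obtain ⟨A, -, hAB, hA, -⟩ := hx.core
  exact hA.mono fun k hk => hk.trans (measure_mono (hAB k))

variable [TopologicalSpace S]

theorem ConcentratesAt.mono (hB : IsBallSystem B) (h : ConcentratesAt 𝒰 B μ ε p s)
    (hst : ScaleLE 𝒰 s t) : ConcentratesAt 𝒰 B μ ε p t := by
  obtain ⟨D, hD, h'⟩ := hst
  intro c hc
  filter_upwards [h (c / D) (by positivity), h'] with k hk hk'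
  refine hk.trans (measure_mono (hB.mono ?_))
  calc c / D * s k ≤ c / D * (D * t k) := by gcongr
    _ = c * t k := by field_simp

theorem concentratesAt_of_scaleLT (hB : IsBallSystem B)
    (h : ∀ᶠ k in (𝒰 : Filter ℕ), ε ≤ μ k (B k (x k) (ρ k))) (hs : ScaleLT 𝒰 ρ s) :
    ConcentratesAt 𝒰 B μ ε x s := by
  intro c hc
  filter_upwards [h, hs c hc] with k hk hk'
  exact hk.trans (measure_mono (hB.mono hk'.le))

theorem IsBubble.concentratesAt (hB : IsBallSystem B) (hx : IsBubble 𝒰 B μ ε a x ρ)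
    (hs : ScaleLT 𝒰 ρ s) : ConcentratesAt 𝒰 B μ ε x s :=
  concentratesAt_of_scaleLT hB hx.eventually_le hs

/-- The radius of a bubble may be enlarged by a constant factor. -/
theorem IsBubble.const_mul (hB : IsBallSystem B) (hx : IsBubble 𝒰 B μ ε a x ρ) {C : ℝ}
    (hC : 1 ≤ C) : IsBubble 𝒰 B μ ε a x fun k => C * ρ k := by
  have hC0 : 0 < C := one_pos.trans_le hC
  obtain ⟨A, hAm, hAB, hA, hconc⟩ := hx.core
  refine ⟨fun k => mul_pos hC0 (hx.pos k), hx.center,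
    (ScaleLE.const_mul_left hC0 ρ).trans_lt hx.radius, A, hAm, fun k => ?_, hA, fun q hq => ?_⟩
  · exact (hAB k).trans (hB.mono (le_mul_of_one_le_left (hx.pos k).le hC))
  · obtain ⟨α, hα, h⟩ := hconc q (hq.mono hB (ScaleLE.const_mul_left hC0 ρ))
    refine ⟨α / C, by positivity, h.mono fun k hk => ?_⟩
    have : α / C * (C * ρ k) = α * ρ k := by field_simp
    rwa [this]

/-- The cores of a small bubble and of a much larger one are disjoint, since the small bubble is a
point of concentration at the scale of the larger one; the cores of distant bubbles are disjoint
since the balls are. -/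
theorem exists_cores_disjoint (hB : IsBallSystem B) {ι : Type*} {x : ι → ℕ → S} {ρ : ι → ℕ → ℝ}
    {a : S} (hx : ∀ j, IsBubble 𝒰 B μ ε a (x j) (ρ j))
    (hsep : ∀ j j', j ≠ j' → Separated 𝒰 B (x j) (ρ j) (x j') (ρ j')) :
    ∃ A : ι → ℕ → Set S, (∀ j k, MeasurableSet (A j k)) ∧
      (∀ j, ∀ᶠ k in (𝒰 : Filter ℕ), ε ≤ μ k (A j k)) ∧
      ∀ j j', j ≠ j' → ∀ᶠ k in (𝒰 : Filter ℕ), Disjoint (A j k) (A j' k) := by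
  choose A hAm hAB hA hconc using fun j => (hx j).core
  have hlt : ∀ j j', ScaleLT 𝒰 (ρ j) (ρ j') →
      ∀ᶠ k in (𝒰 : Filter ℕ), Disjoint (A j k) (A j' k) := by
    intro j j' h
    obtain ⟨α, hα, hdis⟩ := hconc j' (x j) ((hx j).concentratesAt hB h)
    filter_upwards [hdis, h α hα] with k hk hk'
    exact (hk.mono_right ((hAB j k).trans (hB.mono hk'.le))).symm
  refine ⟨A, hAm, hA, fun j j' hjj' => ?_⟩
  rcases hsep j j' hjj' with h | h | h
  · exact hlt j j' h
  · exact (hlt j' j h).mono fun k hk => hk.symm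
  · filter_upwards [eventually_notMem_of_not_within h one_pos] with k hk
    refine Set.disjoint_left.2 fun z hz hz' => hk ?_
    rw [one_mul]
    exact hB.trans (hAB j k hz) (hB.symm (hAB j' k hz'))

/-- A family of pairwise separated bubbles has at most `Λ / ε` elements. -/
theorem card_mul_le_of_separated (hB : IsBallSystem B) {Λ : ℝ≥0∞} (hμ : ∀ k, μ k univ ≤ Λ)
    {n : ℕ} {x : Fin n → ℕ → S} {ρ : Fin n → ℕ → ℝ} {a : S}
    (hx : ∀ j, IsBubble 𝒰 B μ ε a (x j) (ρ j))
    (hsep : ∀ j j', j ≠ j' → Separated 𝒰 B (x j) (ρ j) (x j') (ρ j')) :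
    n * ε ≤ Λ := by
  obtain ⟨A, hAm, hA, hdis⟩ := exists_cores_disjoint hB hx hsep
  have hdis' : ∀ᶠ k in (𝒰 : Filter ℕ), ∀ j j', j ≠ j' → Disjoint (A j k) (A j' k) :=
    eventually_all.2 fun j => eventually_all.2 fun j' =>
      if h : j = j' then Eventually.of_forall fun k hne => absurd h hne
      else (hdis j j' h).mono fun k hk _ => hk
  obtain ⟨k, hk, hk'⟩ := ((eventually_all.2 hA).and hdis').exists
  calc (n : ℝ≥0∞) * ε = ∑ _j : Fin n, ε := by simp
    _ ≤ ∑ j, μ k (A j k) := Finset.sum_le_sum fun j _ => hk j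
    _ = μ k (⋃ j, A j k) := by
        rw [measure_iUnion (fun j j' h => hk' j j' h) fun j => hAm j k, tsum_fintype]
    _ ≤ Λ := (measure_mono (subset_univ _)).trans (hμ k)

/-- Every concentration is caused by a bubble: among the balls of measure at least `ε` near the
concentration points, almost minimal ones form a bubble whose core is the whole ball. -/
theorem ConcentratesAt.exists_bubble [T1Space S] [CompactSpace S] [BorelSpace S]
    (h𝒰 : (𝒰 : Filter ℕ) ≤ atTop) (hB : IsBallSystem B) [∀ k, IsFiniteMeasure (μ k)]
    (hμ : ∀ k p, μ k {p} = 0) (hε : 0 < ε) (hs : ∀ k, 0 < s k)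
    (hp : ConcentratesAt 𝒰 B μ ε p s) (hpa : CloseAtScale 𝒰 B (fun _ => a) p fun _ => 1)
    (hs1 : ScaleLT 𝒰 s fun _ => 1) :
    ∃ y r, IsBubble 𝒰 B μ ε a y r ∧ ScaleLT 𝒰 r s ∧ CloseAtScale 𝒰 B p y s := by
  -- along a diagonal sequence the ball of radius `δ ^ 2 * s`, with `δ → 0`, has measure `≥ ε`
  obtain ⟨M, hM, hMp⟩ := exists_tendsto_diagonal h𝒰 (P := fun N k =>
    ε ≤ μ k (B k (p k) ((1 / ((N : ℝ) + 1)) ^ 2 * s k))) fun N => hp _ (by positivity)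
  set δ : ℕ → ℝ := fun k => 1 / ((M k : ℝ) + 1) with hδ
  have hδ0 : ∀ k, 0 < δ k := fun k => by positivity
  have hδ1 : ∀ k, δ k ≤ 1 := fun k => by
    rw [hδ]
    exact (div_le_one (by positivity)).2 (by linarith [(M k).cast_nonneg (α := ℝ)])
  have hδlim : ∀ c : ℝ, 0 < c → ∀ᶠ k in (𝒰 : Filter ℕ), δ k < c := fun c hc =>
    (tendsto_one_div_add_atTop_nhds_zero_nat.comp hM).eventually (gt_mem_nhds hc)
  have hpick : ∀ k, ∃ (y : S) (r : ℝ), 0 < r ∧ (ε ≤ μ k (B k (p k) (δ k ^ 2 * s k)) →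
      r ≤ δ k ^ 2 * s k ∧ y ∈ B k (p k) (δ k * s k) ∧ ε ≤ μ k (B k y r) ∧
      ∀ q ∈ B k y (r / (2 * δ k)), ∀ r' ≤ r / 2, μ k (B k q r') < ε) := by
    intro k
    by_cases h : ε ≤ μ k (B k (p k) (δ k ^ 2 * s k))
    · obtain ⟨r₀, hr₀, hlt⟩ := hB.exists_forall_measure_lt k (μ k) (hμ k) hε
      obtain ⟨y, r, hr, hrt, hy, hyr, hmin⟩ := hB.exists_almost_minimal k (μ k) hr₀ hlt (hδ0 k)
        (mul_pos (pow_pos (hδ0 k) 2) (hs k)) h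
      have : δ k ^ 2 * s k / δ k = δ k * s k := by
        have := (hδ0 k).ne'
        field_simp
      exact ⟨y, r, hr, fun _ => ⟨hrt, this ▸ hy, hyr, hmin⟩⟩
    · exact ⟨p k, 1, one_pos, fun h' => absurd h' h⟩
  choose y r hr hyr using hpick
  have hev := hMp.mono fun k hk => hyr k hk
  have hrs : ScaleLT 𝒰 r s := by
    intro c hc
    filter_upwards [hev, hδlim c hc] with k hk hδk
    calc r k ≤ δ k ^ 2 * s k := hk.1
      _ ≤ δ k * s k := by
          refine mul_le_mul_of_nonneg_right ?_ (hs k).le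
          nlinarith [hδ0 k, hδ1 k]
      _ < c * s k := mul_lt_mul_of_pos_right hδk (hs k)
  have hpy : CloseAtScale 𝒰 B p y s := by
    intro c hc
    filter_upwards [hev, hδlim c hc] with k hk hδk
    exact hB.mono (mul_le_mul_of_nonneg_right hδk.le (hs k).le) hk.2.1
  refine ⟨y, r, ⟨hr, hpa.trans hB (hpy.mono hB hs1.le), hrs.trans hs1, fun k => B k (y k) (r k),
    fun k => (hB.isOpen k _ _).measurableSet, fun k => Subset.rfl, hev.mono fun k hk => hk.2.2.1,
    fun q hq => ⟨1, one_pos, ?_⟩⟩, hrs, hpy⟩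
  have hfar : ∀ᶠ k in (𝒰 : Filter ℕ), q k ∉ B k (y k) (r k / (2 * δ k)) := by
    rw [Ultrafilter.eventually_not]
    intro hnear
    obtain ⟨k, hk, hqk, hck⟩ := (hev.and (hnear.and (hq (1 / 2) (by positivity)))).exists
    exact (hk.2.2.2 (q k) hqk _ (by linarith)).not_ge hck
  filter_upwards [hfar, hδlim (1 / 4) (by positivity)] with k hk hδk
  refine Set.disjoint_left.2 fun z hz hz' => hk (hB.mono ?_ (hB.trans hz (hB.symm hz')))
  rw [le_div_iff₀ (by linarith [hδ0 k])]
  nlinarith [hr k, hδ0 k]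

end Bubble

/-! ### Maximal families of bubbles -/

section Family

variable {S : Type*} [MeasurableSpace S]

/-- A maximal family of pairwise separated bubbles at `a`. The radii are so large that the ball of
a bubble contains the centers of all bubbles whose distance is bounded by a multiple of the
radius. -/
structure IsMaximalFamily (𝒰 : Ultrafilter ℕ) (B : ℕ → S → ℝ → Set S) (μ : ℕ → Measure S)
    (ε : ℝ≥0∞) (a : S) {n : ℕ} (x : Fin n → ℕ → S) (ρ : Fin n → ℕ → ℝ) : Prop where
  bubble : ∀ j, IsBubble 𝒰 B μ ε a (x j) (ρ j)
  separated : ∀ j j', j ≠ j' → Separated 𝒰 B (x j) (ρ j) (x j') (ρ j')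
  maximal : ∀ y r, IsBubble 𝒰 B μ ε a y r →
    ∃ j, ScaleLE 𝒰 r (ρ j) ∧ ScaleLE 𝒰 (ρ j) r ∧ WithinScale 𝒰 B y (x j) r
  mem_ball : ∀ j j', WithinScale 𝒰 B (x j) (x j') (ρ j) →
    ∀ᶠ k in (𝒰 : Filter ℕ), x j' k ∈ B k (x j k) (ρ j k)

/-- The bubble `j` lies inside the bubble `l`. -/
def IsInner {S : Type*} (𝒰 : Ultrafilter ℕ) (B : ℕ → S → ℝ → Set S) {n : ℕ} (x : Fin n → ℕ → S)
    (ρ : Fin n → ℕ → ℝ) (l j : Fin n) : Prop :=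
  ScaleLT 𝒰 (ρ j) (ρ l) ∧ WithinScale 𝒰 B (x l) (x j) (ρ l)

theorem IsInner.trans {S : Type*} [TopologicalSpace S] {𝒰 : Ultrafilter ℕ}
    {B : ℕ → S → ℝ → Set S} {n : ℕ} {x : Fin n → ℕ → S} {ρ : Fin n → ℕ → ℝ} (hB : IsBallSystem B)
    {l j i : Fin n} (h : IsInner 𝒰 B x ρ l j) (h' : IsInner 𝒰 B x ρ j i) :
    IsInner 𝒰 B x ρ l i :=
  ⟨h'.1.trans h.1, h.2.trans hB (h'.2.mono hB h.1.le)⟩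

/-- A bubble contains, or is itself, a bubble that contains no other one. -/
theorem exists_innermost {S : Type*} [TopologicalSpace S] {𝒰 : Ultrafilter ℕ}
    {B : ℕ → S → ℝ → Set S} {n : ℕ} {x : Fin n → ℕ → S} {ρ : Fin n → ℕ → ℝ} (hB : IsBallSystem B)
    (j : Fin n) : ∃ m, (m = j ∨ IsInner 𝒰 B x ρ j m) ∧ ∀ i, ¬ IsInner 𝒰 B x ρ m i := by
  have : IsTrans (Fin n) fun i j => IsInner 𝒰 B x ρ j i := ⟨fun _ _ _ h h' => h'.trans hB h⟩
  have : Std.Irrefl fun i j : Fin n => IsInner 𝒰 B x ρ j i := ⟨fun _ h => ScaleLT.irrefl h.1⟩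
  have hwf := Finite.wellFounded_of_trans_of_irrefl fun i j : Fin n => IsInner 𝒰 B x ρ j i
  induction j using hwf.induction with
  | _ j ih =>
    by_cases h : ∃ i, IsInner 𝒰 B x ρ j i
    · obtain ⟨i, hi⟩ := h
      obtain ⟨m, rfl | hm, hmin⟩ := ih i hi
      · exact ⟨m, Or.inr hi, hmin⟩
      · exact ⟨m, Or.inr (hi.trans hB hm), hmin⟩
    · exact ⟨j, Or.inl rfl, fun i hi => h ⟨i, hi⟩⟩

variable [TopologicalSpace S] {𝒰 : Ultrafilter ℕ} {B : ℕ → S → ℝ → Set S} {μ : ℕ → Measure S}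
  {ε : ℝ≥0∞} {a : S}

/-- The number of separated bubbles is bounded by the total measure, hence there is a maximal
family; enlarging the radii by constants preserves all other properties. -/
theorem exists_isMaximalFamily (hB : IsBallSystem B) {Λ : ℝ≥0∞} (hΛ : Λ ≠ ⊤)
    (hμ : ∀ k, μ k univ ≤ Λ) (hε : 0 < ε) (a : S) :
    ∃ (n : ℕ) (x : Fin n → ℕ → S) (ρ : Fin n → ℕ → ℝ), IsMaximalFamily 𝒰 B μ ε a x ρ := by
  set P : ℕ → Prop := fun n => ∃ (x : Fin n → ℕ → S) (ρ : Fin n → ℕ → ℝ),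
    (∀ j, IsBubble 𝒰 B μ ε a (x j) (ρ j)) ∧
    ∀ j j', j ≠ j' → Separated 𝒰 B (x j) (ρ j) (x j') (ρ j')
  have hbdd : BddAbove {n | P n} := by
    obtain ⟨N, hN⟩ := ENNReal.exists_nat_mul_gt hε.ne' hΛ
    refine ⟨N, fun n ⟨x, ρ, hx, hsep⟩ => ?_⟩
    by_contra hNn
    have h1 := card_mul_le_of_separated hB hμ hx hsep
    have h2 : (N : ℝ≥0∞) * ε ≤ n * ε := by gcongr; exact (not_le.1 hNn).le
    exact (hN.trans_le (h2.trans h1)).false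
  have h0 : P 0 := ⟨fun j => j.elim0, fun j => j.elim0, fun j => j.elim0, fun j => j.elim0⟩
  obtain ⟨n, ⟨x, ρ, hx, hsep⟩, hn⟩ : ∃ n, P n ∧ ∀ m, P m → m ≤ n :=
    ⟨sSup {n | P n}, Nat.sSup_mem ⟨0, h0⟩ hbdd, fun m hm => le_csSup hbdd hm⟩
  have hmax : ∀ y r, IsBubble 𝒰 B μ ε a y r → ∃ j, ¬ Separated 𝒰 B y r (x j) (ρ j) := by
    intro y r hy
    by_contra! hcon
    have hP1 : P (n + 1) := by
      refine ⟨Fin.cons y x, Fin.cons r ρ, Fin.cases hy hx, ?_⟩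
      refine Fin.cases (Fin.cases (fun h => absurd rfl h) fun j' _ => hcon j') fun j => ?_
      refine Fin.cases (fun _ => (hcon j).symm hB) fun j' hjj' => hsep j j' ?_
      exact fun h => hjj' (congrArg Fin.succ h)
    have := hn _ hP1
    omega
  have hC : ∀ j, ∃ C : ℝ, 1 ≤ C ∧ ∀ j', WithinScale 𝒰 B (x j) (x j') (ρ j) →
      ∀ᶠ k in (𝒰 : Filter ℕ), x j' k ∈ B k (x j k) (C * ρ j k) := by
    intro j
    have h1 : ∀ j', ∃ C : ℝ, 0 < C ∧ (WithinScale 𝒰 B (x j) (x j') (ρ j) →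
        ∀ᶠ k in (𝒰 : Filter ℕ), x j' k ∈ B k (x j k) (C * ρ j k)) := by
      intro j'
      by_cases h : WithinScale 𝒰 B (x j) (x j') (ρ j)
      · obtain ⟨C, hC, h⟩ := h
        exact ⟨C, hC, fun _ => h⟩
      · exact ⟨1, one_pos, fun h' => absurd h' h⟩
    choose C hC0 hC using h1
    have hsum : ∀ j', C j' ≤ ∑ i, C i := fun j' =>
      Finset.single_le_sum (fun i _ => (hC0 i).le) (Finset.mem_univ j')
    refine ⟨1 + ∑ i, C i, by linarith [Finset.sum_nonneg fun i (_ : i ∈ Finset.univ) => (hC0 i).le],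
      fun j' h => (hC j' h).mono fun k hk => hB.mono ?_ hk⟩
    exact mul_le_mul_of_nonneg_right (by linarith [hsum j']) ((hx j).pos k).le
  choose C hC1 hC using hC
  have hC0 : ∀ j, 0 < C j := fun j => one_pos.trans_le (hC1 j)
  have hle : ∀ j, ScaleLE 𝒰 (fun k => C j * ρ j k) (ρ j) := fun j =>
    ScaleLE.const_mul_left (hC0 j) _
  have hge : ∀ j, ScaleLE 𝒰 (ρ j) fun k => C j * ρ j k := fun j =>
    ScaleLE.const_mul_right (hC0 j) _
  refine ⟨n, x, fun j k => C j * ρ j k, fun j => (hx j).const_mul hB (hC1 j), fun j j' h =>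
    (hsep j j' h).of_le hB (hge j) (hle j) (hge j') (hle j') (hx j).pos (hx j').pos,
    fun y r hy => ?_, fun j j' h => hC j j' (h.mono hB (hle j))⟩
  obtain ⟨j, hj⟩ := hmax y r hy
  obtain ⟨h1, h2, h3⟩ := comparable_of_not_separated hB hj
  exact ⟨j, h1.trans (hge j), (hle j).trans h2, h3⟩

variable {n : ℕ} {x : Fin n → ℕ → S} {ρ : Fin n → ℕ → ℝ}

/-- Every concentration near `a` is caused by a bubble of the family. -/
theorem IsMaximalFamily.exists_close [T1Space S] [CompactSpace S] [BorelSpace S]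
    (hx : IsMaximalFamily 𝒰 B μ ε a x ρ) (h𝒰 : (𝒰 : Filter ℕ) ≤ atTop) (hB : IsBallSystem B)
    [∀ k, IsFiniteMeasure (μ k)] (hμ : ∀ k p, μ k {p} = 0) (hε : 0 < ε) {p : ℕ → S} {s : ℕ → ℝ}
    (hs : ∀ k, 0 < s k) (hp : ConcentratesAt 𝒰 B μ ε p s)
    (hpa : CloseAtScale 𝒰 B (fun _ => a) p fun _ => 1) (hs1 : ScaleLT 𝒰 s fun _ => 1) :
    ∃ j, ScaleLT 𝒰 (ρ j) s ∧ CloseAtScale 𝒰 B p (x j) s := by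
  obtain ⟨y, r, hy, hrs, hpy⟩ := hp.exists_bubble h𝒰 hB hμ hε hs hpa hs1
  obtain ⟨j, -, hj, hyj⟩ := hx.maximal y r hy
  exact ⟨j, hj.trans_lt hrs, hpy.trans hB (hyj.close hB hrs)⟩

/-- A bubble carries measure at least `ε` outside of small balls around its inner bubbles: these are
points of concentration at its scale, so the core avoids them. -/
theorem IsMaximalFamily.eventually_le_diff (hx : IsMaximalFamily 𝒰 B μ ε a x ρ)
    (hB : IsBallSystem B) (l : Fin n) : ∃ α : ℝ, 0 < α ∧ α < 1 ∧ ∀ᶠ k in (𝒰 : Filter ℕ),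
      ε ≤ μ k (B k (x l k) (ρ l k) \
        ⋃ j ∈ {j | IsInner 𝒰 B x ρ l j}, B k (x j k) (α * ρ l k)) := by
  obtain ⟨A, -, hAB, hA, hconc⟩ := (hx.bubble l).core
  have h1 : ∀ j, ∃ α : ℝ, 0 < α ∧ (IsInner 𝒰 B x ρ l j →
      ∀ᶠ k in (𝒰 : Filter ℕ), Disjoint (A k) (B k (x j k) (α * ρ l k))) := by
    intro j
    by_cases h : IsInner 𝒰 B x ρ l j
    · obtain ⟨α, hα, hd⟩ := hconc (x j) ((hx.bubble j).concentratesAt hB h.1)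
      exact ⟨α, hα, fun _ => hd⟩
    · exact ⟨1, one_pos, fun h' => absurd h' h⟩
  choose α hα hd using h1
  obtain ⟨β, hβ, hβα⟩ : ∃ β : ℝ, 0 < β ∧ ∀ j, β ≤ α j := by
    have h : ∀ᶠ β in 𝓝[>] (0 : ℝ), ∀ j, β ∈ Ioo 0 (α j) :=
      eventually_all.2 fun j => Ioo_mem_nhdsGT (hα j)
    obtain ⟨β, hβ, h⟩ := (eventually_mem_nhdsWithin.and h).exists
    exact ⟨β, hβ, fun j => (h j).2.le⟩
  refine ⟨min β (1 / 2), by positivity, (min_le_right _ _).trans_lt (by norm_num), ?_⟩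
  have hall : ∀ᶠ k in (𝒰 : Filter ℕ), ∀ j, IsInner 𝒰 B x ρ l j →
      Disjoint (A k) (B k (x j k) (α j * ρ l k)) := eventually_all.2 fun j =>
    eventually_imp_distrib_left.2 (hd j)
  filter_upwards [hA, hall] with k hk hdk
  refine hk.trans (measure_mono fun z hz => ⟨hAB k hz, fun hz' => ?_⟩)
  obtain ⟨j, hj, hzj⟩ := mem_iUnion₂.1 hz'
  refine Set.disjoint_left.1 (hdk j hj) hz (hB.mono ?_ hzj)
  exact mul_le_mul_of_nonneg_right ((min_le_left _ _).trans (hβα j)) ((hx.bubble l).pos k).le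

/-- At the scale of a bubble the measure does not concentrate away from the inner bubbles. -/
theorem IsMaximalFamily.exists_radius_lower_bound [T1Space S] [CompactSpace S] [BorelSpace S]
    (hx : IsMaximalFamily 𝒰 B μ ε a x ρ) (h𝒰 : (𝒰 : Filter ℕ) ≤ atTop) (hB : IsBallSystem B)
    [∀ k, IsFiniteMeasure (μ k)] (hμ : ∀ k p, μ k {p} = 0) (hε : 0 < ε) (l : Fin n) {α : ℝ}
    (hα : 0 < α) : ∃ c : ℝ, 0 < c ∧ ∀ᶠ k in (𝒰 : Filter ℕ), ∀ y r, 0 < r →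
      B k y r ⊆ B k (x l k) (α⁻¹ * ρ l k) \
        ⋃ j ∈ {j | IsInner 𝒰 B x ρ l j}, B k (x j k) (α * ρ l k) →
      ε ≤ μ k (B k y r) → c * ρ l k ≤ r := by
  by_contra! hcon
  have hbad : ∀ N : ℕ, ∀ᶠ k in (𝒰 : Filter ℕ), ∃ y r, 0 < r ∧
      B k y r ⊆ B k (x l k) (α⁻¹ * ρ l k) \
        ⋃ j ∈ {j | IsInner 𝒰 B x ρ l j}, B k (x j k) (α * ρ l k) ∧
      ε ≤ μ k (B k y r) ∧ r < 1 / ((N : ℝ) + 1) * ρ l k := fun N =>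
    hcon _ (by positivity)
  obtain ⟨M, hM, hev⟩ := exists_tendsto_diagonal h𝒰 hbad
  obtain ⟨y, hev⟩ := hev.choice
  obtain ⟨r, hev⟩ := hev.choice
  have hlt : ScaleLT 𝒰 r (ρ l) := by
    intro c hc
    filter_upwards [hev, (tendsto_one_div_add_atTop_nhds_zero_nat.comp hM).eventually
      (gt_mem_nhds hc)] with k hk hMk
    exact hk.2.2.2.trans_le (mul_le_mul_of_nonneg_right hMk.le ((hx.bubble l).pos k).le)
  have hy : ∀ᶠ k in (𝒰 : Filter ℕ), y k ∈ B k (x l k) (α⁻¹ * ρ l k) \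
      ⋃ j ∈ {j | IsInner 𝒰 B x ρ l j}, B k (x j k) (α * ρ l k) :=
    hev.mono fun k hk => hk.2.1 (hB.mem_self k _ hk.1)
  have hconc : ConcentratesAt 𝒰 B μ ε y (ρ l) :=
    concentratesAt_of_scaleLT hB (hev.mono fun k hk => hk.2.2.1) hlt
  have hly : WithinScale 𝒰 B (x l) y (ρ l) := ⟨α⁻¹, inv_pos.2 hα, hy.mono fun k hk => hk.1⟩
  obtain ⟨j, hj, hyj⟩ := hx.exists_close h𝒰 hB hμ hε (hx.bubble l).pos hconc
    ((hx.bubble l).center.trans hB (hly.close hB (hx.bubble l).radius)) (hx.bubble l).radius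
  have hin : IsInner 𝒰 B x ρ l j := ⟨hj, hly.trans hB hyj.within⟩
  obtain ⟨k, hk, hk'⟩ := (hy.and (hyj α hα)).exists
  exact hk.2 (mem_iUnion₂.2 ⟨j, hin, hB.symm hk'⟩)

end Family

/-! ### The neck region -/

/-- The neck region of finitely many families of balls, with prescribed index sets `I i l` of the
balls inside the ball `l` of the family `i`. -/
def neckSet {S : Type*} (B : ℕ → S → ℝ → Set S) {n : ℕ} (a : Fin n → S) {Q : Fin n → ℕ}
    (I : ∀ i, Fin (Q i) → Set (Fin (Q i))) (x : ∀ i, Fin (Q i) → ℕ → S)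
    (ρ : ∀ i, Fin (Q i) → ℕ → ℝ) (α : ℝ) (k : ℕ) : Set S :=
  ⋃ i, ((B k (a i) α \ ⋃ j, B k (x i j k) (α⁻¹ * ρ i j k)) ∪
    ⋃ l, ⋃ j ∈ I i l, (B k (x i j k) (α * ρ i l k) \
      ⋃ j' ∈ I i l, B k (x i j' k) (α⁻¹ * ρ i j' k)))

section Neck

variable {S : Type*} [MeasurableSpace S] [TopologicalSpace S] {𝒰 : Ultrafilter ℕ}
  {B : ℕ → S → ℝ → Set S} {μ : ℕ → Measure S} {ε : ℝ≥0∞} {n : ℕ} {a : Fin n → S} {Q : Fin n → ℕ}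
  {x : ∀ i, Fin (Q i) → ℕ → S} {ρ : ∀ i, Fin (Q i) → ℕ → ℝ} {α : ℕ → ℝ}

/-- Points in neck regions whose parameter `α` tends to zero: they tend to one of the points `a i`
and are either far, at their scales, from all bubbles at `a i`, or close, at the scale of some
bubble `l`, to a bubble inside `l`, but far from all bubbles inside `l` at their scales. -/
theorem neckSet_cases (hB : IsBallSystem B)
    (hx : ∀ i, IsMaximalFamily 𝒰 B μ ε (a i) (x i) (ρ i)) (hα0 : ∀ k, 0 < α k)
    (hα : ∀ c : ℝ, 0 < c → ∀ᶠ k in (𝒰 : Filter ℕ), α k < c) {p : ℕ → S}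
    (hp : ∀ᶠ k in (𝒰 : Filter ℕ),
      p k ∈ neckSet B a (fun i l => {j | IsInner 𝒰 B (x i) (ρ i) l j}) x ρ (α k) k) :
    ∃ i, CloseAtScale 𝒰 B (fun _ => a i) p (fun _ => 1) ∧
      ((∀ j, ¬ WithinScale 𝒰 B (x i j) p (ρ i j)) ∨
        ∃ l j, IsInner 𝒰 B (x i) (ρ i) l j ∧ CloseAtScale 𝒰 B (x i j) p (ρ i l) ∧
          ∀ j', IsInner 𝒰 B (x i) (ρ i) l j' → ¬ WithinScale 𝒰 B (x i j') p (ρ i j')) := by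
  have hfar : ∀ i j, (∀ᶠ k in (𝒰 : Filter ℕ), p k ∉ B k (x i j k) ((α k)⁻¹ * ρ i j k)) →
      ¬ WithinScale 𝒰 B (x i j) p (ρ i j) := by
    rintro i j h ⟨C, hC, hC'⟩
    obtain ⟨k, hk, hk', hαk⟩ := (h.and (hC'.and (hα C⁻¹ (inv_pos.2 hC)))).exists
    refine hk (hB.mono (mul_le_mul_of_nonneg_right ?_ (((hx i).bubble j).pos k).le) hk')
    exact ((lt_inv_comm₀ (hα0 k) hC).1 hαk).le
  simp only [neckSet, mem_iUnion, mem_union] at hp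
  obtain ⟨i, hi⟩ := Ultrafilter.eventually_exists_iff.1 hp
  refine ⟨i, ?_⟩
  rcases Ultrafilter.eventually_or.1 hi with h | h
  · refine ⟨fun c hc => ?_, Or.inl fun j => hfar i j ?_⟩
    · filter_upwards [h, hα c hc] with k hk hαk
      exact hB.mono (by rw [mul_one]; exact hαk.le) hk.1
    · filter_upwards [h] with k hk hk'
      exact hk.2 (mem_iUnion.2 ⟨j, hk'⟩)
  · obtain ⟨l, hl⟩ := Ultrafilter.eventually_exists_iff.1 h
    obtain ⟨j, hj⟩ := Ultrafilter.eventually_exists_iff.1 hl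
    have hlj : IsInner 𝒰 B (x i) (ρ i) l j := by
      obtain ⟨k, hk, -⟩ := hj.exists
      exact hk
    have hclose : CloseAtScale 𝒰 B (x i j) p (ρ i l) := by
      intro c hc
      filter_upwards [hj, hα c hc] with k hk hαk
      obtain ⟨-, hk, -⟩ := hk
      exact hB.mono (mul_le_mul_of_nonneg_right hαk.le (((hx i).bubble l).pos k).le) hk
    refine ⟨((hx i).bubble j).center.trans hB (hclose.mono hB ((hx i).bubble l).radius.le),
      Or.inr ⟨l, j, hlj, hclose, fun j' hj' => hfar i j' ?_⟩⟩
    filter_upwards [hj] with k hk hk'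
    obtain ⟨-, -, hk⟩ := hk
    exact hk (mem_iUnion₂.2 ⟨j', hj', hk'⟩)

omit [MeasurableSpace S] in
theorem eq_of_closeAtScale [T1Space S] (h𝒰 : (𝒰 : Filter ℕ) ≤ atTop) (hB : IsBallSystem B)
    (ha : Function.Injective a) {p : ℕ → S} {i i' : Fin n}
    (h : CloseAtScale 𝒰 B (fun _ => a i) p fun _ => 1)
    (h' : CloseAtScale 𝒰 B (fun _ => a i') p fun _ => 1) : i = i' :=
  ha ((h.trans hB (h'.symm hB)).eq_of_const hB h𝒰)

/-- The center of an innermost bubble does not lie in the neck region. -/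
theorem not_eventually_mem_neckSet_of_innermost [T1Space S] (h𝒰 : (𝒰 : Filter ℕ) ≤ atTop)
    (hB : IsBallSystem B) (ha : Function.Injective a)
    (hx : ∀ i, IsMaximalFamily 𝒰 B μ ε (a i) (x i) (ρ i)) (hα0 : ∀ k, 0 < α k)
    (hα : ∀ c : ℝ, 0 < c → ∀ᶠ k in (𝒰 : Filter ℕ), α k < c) {i : Fin n} {m : Fin (Q i)}
    (hm : ∀ j, ¬ IsInner 𝒰 B (x i) (ρ i) m j) :
    ¬ ∀ᶠ k in (𝒰 : Filter ℕ),
      x i m k ∈ neckSet B a (fun i l => {j | IsInner 𝒰 B (x i) (ρ i) l j}) x ρ (α k) k := by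
  intro hmem
  obtain ⟨i', hi', hcase⟩ := neckSet_cases hB hx hα0 hα hmem
  obtain rfl := eq_of_closeAtScale h𝒰 hB ha ((hx i).bubble m).center hi'
  have hself := WithinScale.refl (𝒰 := 𝒰) hB (x i m) ((hx i).bubble m).pos
  rcases hcase with h | ⟨l, j, hlj, hclose, hfar⟩
  · exact h m hself
  · have hlm := hlj.2.trans hB hclose.within
    have hnlt : ¬ ScaleLT 𝒰 (ρ i m) (ρ i l) := fun h => hfar m ⟨h, hlm⟩ hself
    by_cases hml : m = l
    · subst hml
      exact hm j hlj
    · rcases (hx i).separated m l hml with h | h | h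
      · exact hnlt h
      · exact hm l ⟨h, (hlm.mono hB h.le).symm hB⟩
      · refine h ((hlm.mono hB ⟨1, one_pos, Eventually.of_forall fun k => ?_⟩).symm hB)
        linarith [((hx i).bubble m).pos k]

/-- In the part of the neck region around the bubbles inside a bubble `l` there are no balls of
radius comparable to `ρ i l`: they would contain the center of an innermost bubble. -/
theorem false_of_ball_subset_neckSet [T1Space S] (h𝒰 : (𝒰 : Filter ℕ) ≤ atTop)
    (hB : IsBallSystem B) (ha : Function.Injective a)
    (hx : ∀ i, IsMaximalFamily 𝒰 B μ ε (a i) (x i) (ρ i)) (hα0 : ∀ k, 0 < α k)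
    (hα : ∀ c : ℝ, 0 < c → ∀ᶠ k in (𝒰 : Filter ℕ), α k < c) {i : Fin n} {l j : Fin (Q i)}
    (hlj : IsInner 𝒰 B (x i) (ρ i) l j) {z : ℕ → S} (hz : CloseAtScale 𝒰 B (x i j) z (ρ i l))
    {r : ℕ → ℝ} (hr : ScaleLE 𝒰 (ρ i l) r) {c : ℝ} (hc : 0 < c)
    (hsub : ∀ᶠ k in (𝒰 : Filter ℕ), B k (z k) (c * r k) ⊆
      neckSet B a (fun i l => {j | IsInner 𝒰 B (x i) (ρ i) l j}) x ρ (α k) k) : False := by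
  obtain ⟨m, hm, hmin⟩ := exists_innermost (𝒰 := 𝒰) (x := x i) (ρ := ρ i) hB j
  refine not_eventually_mem_neckSet_of_innermost h𝒰 hB ha hx hα0 hα hmin ?_
  have hjm : WithinScale 𝒰 B (x i j) (x i m) (ρ i j) := by
    rcases hm with rfl | hm
    · exact WithinScale.refl hB _ ((hx i).bubble m).pos
    · exact hm.2
  have hzm := ((hz.symm hB).trans hB (hjm.close hB hlj.1)).mono hB hr
  filter_upwards [hsub, hzm c hc] with k hk hk'
  exact hk hk'

/-- The neck region contains no ball around the center of a bubble of much smaller radius. -/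
theorem false_of_bubble_ball_subset_neckSet [T1Space S] (h𝒰 : (𝒰 : Filter ℕ) ≤ atTop)
    (hB : IsBallSystem B) (ha : Function.Injective a)
    (hx : ∀ i, IsMaximalFamily 𝒰 B μ ε (a i) (x i) (ρ i)) (hα0 : ∀ k, 0 < α k)
    (hα : ∀ c : ℝ, 0 < c → ∀ᶠ k in (𝒰 : Filter ℕ), α k < c) {i : Fin n} {j : Fin (Q i)}
    {r : ℕ → ℝ} (hr0 : ∀ k, 0 < r k) (hr : ScaleLT 𝒰 (ρ i j) r) {c : ℝ} (hc : 0 < c)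
    (hsub : ∀ᶠ k in (𝒰 : Filter ℕ), B k (x i j k) (c * r k) ⊆
      neckSet B a (fun i l => {j | IsInner 𝒰 B (x i) (ρ i) l j}) x ρ (α k) k) : False := by
  have hself := WithinScale.refl (𝒰 := 𝒰) hB (x i j) ((hx i).bubble j).pos
  obtain ⟨i', hi', hcase⟩ := neckSet_cases hB hx hα0 hα
    (hsub.mono fun k hk => hk (hB.mem_self k (x i j k) (mul_pos hc (hr0 k))))
  obtain rfl := eq_of_closeAtScale h𝒰 hB ha ((hx i).bubble j).center hi'
  rcases hcase with h | ⟨l, j', hlj', hclose, hfar⟩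
  · exact h j hself
  · have hlj := hlj'.2.trans hB hclose.within
    have hnlt : ¬ ScaleLT 𝒰 (ρ i j) (ρ i l) := fun h => hfar j ⟨h, hlj⟩ hself
    exact false_of_ball_subset_neckSet h𝒰 hB ha hx hα0 hα hlj' hclose
      ((scaleLE_of_not_scaleLT hnlt).trans hr.le) hc hsub

/-- The neck region contains no ball of radius and distance comparable to a bubble. -/
theorem false_of_comparable_ball_subset_neckSet [T1Space S] (h𝒰 : (𝒰 : Filter ℕ) ≤ atTop)
    (hB : IsBallSystem B) (ha : Function.Injective a)
    (hx : ∀ i, IsMaximalFamily 𝒰 B μ ε (a i) (x i) (ρ i)) (hα0 : ∀ k, 0 < α k)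
    (hα : ∀ c : ℝ, 0 < c → ∀ᶠ k in (𝒰 : Filter ℕ), α k < c) {i : Fin n} {j : Fin (Q i)}
    {z : ℕ → S} {r : ℕ → ℝ} (hr0 : ∀ k, 0 < r k) (hr : ScaleLE 𝒰 r (ρ i j))
    (hr' : ScaleLE 𝒰 (ρ i j) r) (hz : WithinScale 𝒰 B (x i j) z r) {c : ℝ} (hc : 0 < c)
    (hsub : ∀ᶠ k in (𝒰 : Filter ℕ), B k (z k) (c * r k) ⊆
      neckSet B a (fun i l => {j | IsInner 𝒰 B (x i) (ρ i) l j}) x ρ (α k) k) : False := by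
  obtain ⟨i', hi', hcase⟩ := neckSet_cases hB hx hα0 hα
    (hsub.mono fun k hk => hk (hB.mem_self k (z k) (mul_pos hc (hr0 k))))
  have hz' := hz.mono hB hr
  obtain rfl := eq_of_closeAtScale h𝒰 hB ha (((hx i).bubble j).center.trans hB
    (hz'.close hB ((hx i).bubble j).radius)) hi'
  rcases hcase with h | ⟨l, j', hlj', hclose, hfar⟩
  · exact h j hz'
  · have hlz := hlj'.2.trans hB hclose.within
    have hnlt : ¬ ScaleLT 𝒰 (ρ i j) (ρ i l) := fun h =>
      hfar j ⟨h, hlz.trans hB ((hz'.mono hB h.le).symm hB)⟩ hz'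
    exact false_of_ball_subset_neckSet h𝒰 hB ha hx hα0 hα hlj' hclose
      ((scaleLE_of_not_scaleLT hnlt).trans hr') hc hsub

/-- The radii of balls in neck regions whose parameter tends to zero tend to zero, since the points
`a i` are not isolated. -/
theorem scaleLT_one_of_ball_subset_neckSet [T1Space S] (hS : ∀ p : S, (𝓝[≠] p).NeBot)
    (h𝒰 : (𝒰 : Filter ℕ) ≤ atTop) (hB : IsBallSystem B)
    (hx : ∀ i, IsMaximalFamily 𝒰 B μ ε (a i) (x i) (ρ i)) (hα0 : ∀ k, 0 < α k)
    (hα : ∀ c : ℝ, 0 < c → ∀ᶠ k in (𝒰 : Filter ℕ), α k < c)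
    {z : ℕ → S} {r : ℕ → ℝ} (hr0 : ∀ k, 0 < r k) {c : ℝ} (hc : 0 < c)
    (hsub : ∀ᶠ k in (𝒰 : Filter ℕ), B k (z k) (c * r k) ⊆
      neckSet B a (fun i l => {j | IsInner 𝒰 B (x i) (ρ i) l j}) x ρ (α k) k) :
    ScaleLT 𝒰 r fun _ => 1 := by
  by_contra hnlt
  obtain ⟨C, hC, hCr⟩ := scaleLE_of_not_scaleLT hnlt
  obtain ⟨i, hi, -⟩ := neckSet_cases hB hx hα0 hα
    (hsub.mono fun k hk => hk (hB.mem_self k (z k) (mul_pos hc (hr0 k))))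
  -- a point near `a i`, different from all `a i'`, that would have to lie in the neck region
  have hd : 0 < c / (2 * C) := by positivity
  have hne : ∀ᶠ w in 𝓝[≠] a i, w ∉ range a := by
    have h1 : ∀ᶠ w in 𝓝 (a i), w ∉ range a \ {a i} :=
      ((finite_range a).sdiff).isClosed.isOpen_compl.mem_nhds fun h => h.2 rfl
    filter_upwards [mem_nhdsWithin_of_mem_nhds h1, self_mem_nhdsWithin] with w hw hwa hwr
    exact hw ⟨hwr, hwa⟩
  obtain ⟨w, hwa, hw⟩ := (hne.and (mem_nhdsWithin_of_mem_nhds (hB.eventually_mem (a i) hd))).exists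
  have hwmem : ∀ᶠ k in (𝒰 : Filter ℕ), w ∈
      neckSet B a (fun i l => {j | IsInner 𝒰 B (x i) (ρ i) l j}) x ρ (α k) k := by
    filter_upwards [hsub, h𝒰 hw, hi _ hd, hCr] with k hk hwk hzk hCk
    refine hk (hB.mono ?_ (hB.trans (hB.symm hzk) hwk))
    calc c / (2 * C) * 1 + c / (2 * C) = c * (1 / C) := by field_simp; norm_num
      _ ≤ c * r k := by
        gcongr
        rwa [div_le_iff₀' hC]
  obtain ⟨i', hi', -⟩ := neckSet_cases hB hx hα0 hα (p := fun _ => w) hwmem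
  exact hwa ⟨i', hi'.eq_of_const hB h𝒰⟩

/-- Annuli in the neck region have measure less than `ε`, if the parameter is small enough:
otherwise annuli in neck regions with parameters tending to zero form a bubble, which would have to
be comparable to one of the maximal family. -/
theorem exists_neckSet_annulus_lt [T1Space S] [CompactSpace S] [BorelSpace S]
    (hS : ∀ p : S, (𝓝[≠] p).NeBot) (h𝒰 : (𝒰 : Filter ℕ) ≤ atTop) (hB : IsBallSystem B)
    [∀ k, IsFiniteMeasure (μ k)] (hμ : ∀ k p, μ k {p} = 0) (hε : 0 < ε)
    (ha : Function.Injective a) (hx : ∀ i, IsMaximalFamily 𝒰 B μ ε (a i) (x i) (ρ i)) {β : ℝ}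
    (hβ : 1 < β) : ∃ α : ℝ, 0 < α ∧ α < 1 ∧ ∀ᶠ k in (𝒰 : Filter ℕ), ∀ y r, 0 < r →
      B k y (β * (2 * r)) \ B k y (β⁻¹ * r) ⊆
        neckSet B a (fun i l => {j | IsInner 𝒰 B (x i) (ρ i) l j}) x ρ α k →
      μ k (B k y (2 * r) \ B k y r) < ε := by
  by_contra! hcon
  set N : ℝ → ℕ → Set S := neckSet B a (fun i l => {j | IsInner 𝒰 B (x i) (ρ i) l j}) x ρ
  have hbad : ∀ M : ℕ, ∀ᶠ k in (𝒰 : Filter ℕ), ∃ (y : S) (r : {r : ℝ // 0 < r}),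
      B k y (β * (2 * r)) \ B k y (β⁻¹ * r) ⊆ N (1 / ((M : ℝ) + 2)) k ∧
        ε ≤ μ k (B k y (2 * r) \ B k y r) := by
    intro M
    refine (hcon (1 / ((M : ℝ) + 2)) (by positivity) ?_).mono fun k ⟨y, r, hr, h⟩ => ⟨y, ⟨r, hr⟩, h⟩
    rw [div_lt_one (by positivity)]
    linarith [M.cast_nonneg (α := ℝ)]
  obtain ⟨M, hM, hev⟩ := exists_tendsto_diagonal h𝒰 hbad
  obtain ⟨y, hev⟩ := hev.choice
  obtain ⟨r', hev⟩ := hev.choice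
  set r : ℕ → ℝ := fun k => r' k
  have hr0 : ∀ k, 0 < r k := fun k => (r' k).2
  set α : ℕ → ℝ := fun k => 1 / ((M k : ℝ) + 2) with hαdef
  have hα0 : ∀ k, 0 < α k := fun k => by positivity
  have hα : ∀ c : ℝ, 0 < c → ∀ᶠ k in (𝒰 : Filter ℕ), α k < c := by
    intro c hc
    filter_upwards [(tendsto_one_div_add_atTop_nhds_zero_nat.comp hM).eventually
      (gt_mem_nhds hc)] with k hk
    refine lt_of_le_of_lt ?_ hk
    exact one_div_le_one_div_of_le (by positivity) (by linarith)
  -- a ball around a point of the annulus whose radius is a fixed multiple of `r` is in the neck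
  obtain ⟨c, hc, hc1, hc2⟩ : ∃ c : ℝ, 0 < c ∧ c ≤ 1 - β⁻¹ ∧ c ≤ 2 * β - 2 :=
    ⟨min (1 - β⁻¹) (2 * β - 2), lt_min (sub_pos.2 (inv_lt_one_of_one_lt₀ hβ)) (by linarith),
      min_le_left _ _, min_le_right _ _⟩
  have hsub : ∀ᶠ k in (𝒰 : Filter ℕ), ∀ z ∈ B k (y k) (2 * r k) \ B k (y k) (r k),
      B k z (c * r k) ⊆ N (α k) k := by
    filter_upwards [hev] with k hk z hz w hw
    refine hk.1 ⟨hB.mono ?_ (hB.trans hz.1 hw), fun hw' => hz.2 (hB.mono ?_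
      (hB.trans hw' (hB.symm hw)))⟩
    · change 2 * r k + c * r k ≤ β * (2 * r k)
      nlinarith [hr0 k]
    · change β⁻¹ * r k + c * r k ≤ r k
      nlinarith [hr0 k]
  have hzex : ∀ᶠ k in (𝒰 : Filter ℕ), ∃ z, z ∈ B k (y k) (2 * r k) \ B k (y k) (r k) :=
    hev.mono fun k hk => nonempty_of_measure_ne_zero (hε.trans_le hk.2).ne'
  obtain ⟨z, hz⟩ := hzex.choice
  have hzsub := (hsub.and hz).mono fun k hk => hk.1 _ hk.2
  have hr1 : ScaleLT 𝒰 r fun _ => 1 :=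
    scaleLT_one_of_ball_subset_neckSet hS h𝒰 hB hx hα0 hα hr0 hc hzsub
  obtain ⟨i, hi, -⟩ := neckSet_cases hB hx hα0 hα
    (hzsub.mono fun k hk => hk (hB.mem_self k (z k) (mul_pos hc (hr0 k))))
  have hyz : WithinScale 𝒰 B y z r := ⟨2, two_pos, hz.mono fun k hk => hk.1⟩
  have h2r : ScaleLE 𝒰 (fun k => 2 * r k) r := ScaleLE.const_mul_left two_pos r
  have h2r' : ScaleLE 𝒰 r (fun k => 2 * r k) := ScaleLE.const_mul_right two_pos r
  have hbub : IsBubble 𝒰 B μ ε (a i) y fun k => 2 * r k := by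
    refine ⟨fun k => mul_pos two_pos (hr0 k), hi.trans hB ((hyz.symm hB).close hB hr1),
      h2r.trans_lt hr1, fun k => B k (y k) (2 * r k) \ B k (y k) (r k),
      fun k => (hB.isOpen k _ _).measurableSet.diff (hB.isOpen k _ _).measurableSet,
      fun k => sdiff_subset, hev.mono fun k hk => hk.2, fun q hq => ⟨c / 8, by positivity, ?_⟩⟩
    by_contra hcon'
    have hmeet : ∀ᶠ k in (𝒰 : Filter ℕ), ∃ z', z' ∈ B k (y k) (2 * r k) \ B k (y k) (r k) ∧
        z' ∈ B k (q k) (c / 8 * (2 * r k)) :=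
      (Ultrafilter.eventually_not.2 hcon').mono fun k hk => Set.not_disjoint_iff.1 hk
    obtain ⟨z', hz'⟩ := hmeet.choice
    have hz'sub := (hsub.and hz').mono fun k hk => hk.1 _ hk.2.1
    obtain ⟨i', hi', -⟩ := neckSet_cases hB hx hα0 hα
      (hz'sub.mono fun k hk => hk (hB.mem_self k (z' k) (mul_pos hc (hr0 k))))
    have hqz' : WithinScale 𝒰 B q z' fun k => 2 * r k :=
      ⟨c / 8, by positivity, hz'.mono fun k hk => hk.2⟩
    obtain ⟨j, hj, hqj⟩ := (hx i').exists_close h𝒰 hB hμ hε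
      (fun k => mul_pos two_pos (hr0 k)) hq
      (hi'.trans hB ((hqz'.symm hB).close hB (h2r.trans_lt hr1))) (h2r.trans_lt hr1)
    refine false_of_bubble_ball_subset_neckSet h𝒰 hB ha hx hα0 hα hr0 (hj.trans_le h2r)
      (half_pos hc) ?_
    filter_upwards [hz'sub, hz', hqj (c / 8) (by positivity)] with k hk hk' hqk w hw
    refine hk (hB.mono ?_ (hB.trans (hB.trans (hB.symm hk'.2) hqk) hw))
    linarith
  obtain ⟨j, hj, hj', hyj⟩ := (hx i).maximal _ _ hbub
  exact false_of_comparable_ball_subset_neckSet h𝒰 hB ha hx hα0 hα hr0 (h2r'.trans hj)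
    (hj'.trans h2r) (((hyj.mono hB h2r).symm hB).trans hB hyz) hc hzsub

end Neck

section Monotone

variable {S : Type*} [TopologicalSpace S] {B : ℕ → S → ℝ → Set S} {n : ℕ} {a : Fin n → S}
  {Q : Fin n → ℕ} {I : ∀ i, Fin (Q i) → Set (Fin (Q i))} {x : ∀ i, Fin (Q i) → ℕ → S}
  {ρ : ∀ i, Fin (Q i) → ℕ → ℝ}

theorem neckSet_mono (hB : IsBallSystem B) (hρ : ∀ i j k, 0 < ρ i j k) {α α' : ℝ} (hα : 0 < α)
    (h : α ≤ α') (k : ℕ) : neckSet B a I x ρ α k ⊆ neckSet B a I x ρ α' k := by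
  have hinv : α'⁻¹ ≤ α⁻¹ := inv_anti₀ hα h
  have hsub : ∀ i j, B k (x i j k) (α'⁻¹ * ρ i j k) ⊆ B k (x i j k) (α⁻¹ * ρ i j k) :=
    fun i j => hB.mono (mul_le_mul_of_nonneg_right hinv (hρ i j k).le)
  refine iUnion_mono fun i => union_subset_union ?_ ?_
  · exact sdiff_subset_sdiff (hB.mono h) (iUnion_mono fun j => hsub i j)
  · refine iUnion_mono fun l => iUnion₂_mono fun j _ => sdiff_subset_sdiff ?_ ?_
    · exact hB.mono (mul_le_mul_of_nonneg_right h (hρ i l k).le)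
    · exact iUnion₂_mono fun j' _ => hsub i j'

/-- For a fixed index `k` the measure of the neck region tends to zero with its parameter. -/
theorem eventually_measure_neckSet_lt [T1Space S] [MeasurableSpace S] [BorelSpace S]
    (hB : IsBallSystem B) (hρ : ∀ i j k, 0 < ρ i j k) (k : ℕ) (ν : Measure S) [IsFiniteMeasure ν]
    (hν : ∀ p, ν {p} = 0) {ε : ℝ≥0∞} (hε : 0 < ε) :
    ∀ᶠ α in 𝓝[>] (0 : ℝ), ν (neckSet B a I x ρ α k) < ε := by
  have hball : ∀ (p : S) (s : ℝ), 0 < s →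
      Tendsto (fun α : ℝ => ν (B k p (α * s))) (𝓝[>] 0) (𝓝 0) := by
    intro p s hs
    refine ENNReal.tendsto_nhds_zero.2 fun η hη => ?_
    obtain ⟨r, hr, hrη⟩ := hB.exists_measure_lt k ν p (hν p) hη
    filter_upwards [Ioo_mem_nhdsGT (div_pos hr hs)] with α hα
    exact (measure_mono (hB.mono ((lt_div_iff₀ hs).1 hα.2).le)).trans hrη.le
  have hlim : Tendsto (fun α : ℝ => ∑ i, (ν (B k (a i) (α * 1)) +
      ∑ l, ∑ j, ν (B k (x i j k) (α * ρ i l k)))) (𝓝[>] 0)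
      (𝓝 (∑ i : Fin n, (0 + ∑ _l : Fin (Q i), ∑ _j : Fin (Q i), 0))) :=
    tendsto_finsetSum _ fun i _ => (hball (a i) 1 one_pos).add
      (tendsto_finsetSum _ fun l _ => tendsto_finsetSum _ fun j _ => hball _ _ (hρ i l k))
  simp only [Finset.sum_const_zero, add_zero] at hlim
  filter_upwards [hlim.eventually (gt_mem_nhds hε)] with α hα
  refine lt_of_le_of_lt ?_ hα
  refine (measure_iUnion_fintype_le ν _).trans (Finset.sum_le_sum fun i _ => ?_)
  refine (measure_union_le _ _).trans (add_le_add (measure_mono ?_) ?_)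
  · rw [mul_one]
    exact sdiff_subset
  · refine (measure_iUnion_fintype_le ν _).trans (Finset.sum_le_sum fun l _ => ?_)
    refine (measure_iUnion_fintype_le ν _).trans (Finset.sum_le_sum fun j _ => measure_mono ?_)
    exact iUnion_subset fun _ => sdiff_subset

end Monotone

/-! ### Passing from the ultrafilter to a subsequence -/

theorem exists_strictMono_of_eventually {𝒰 : Ultrafilter ℕ} (h𝒰 : (𝒰 : Filter ℕ) ≤ atTop)
    {P : ℕ → ℕ → Prop} (h : ∀ N, ∀ᶠ k in (𝒰 : Filter ℕ), P N k) :
    ∃ σ : ℕ → ℕ, StrictMono σ ∧ ∀ N, ∀ k ≥ N, P N (σ k) := by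
  obtain ⟨σ, hσ, hσP⟩ := extraction_forall_of_frequently (P := fun N k => ∀ M ≤ N, P M k)
    fun N => ((eventually_all_finite (Set.finite_Iic N)).2 fun M _ => h M).frequently.filter_mono
      h𝒰
  exact ⟨σ, hσ, fun N k hk => hσP k N hk⟩

section Subsequence

variable {S : Type*} [TopologicalSpace S] [T1Space S] [CompactSpace S] [MeasurableSpace S]
  [BorelSpace S]

/-- The bubble-neck decomposition for a sequence of atomless measures of bounded mass on a compact
space. -/
theorem exists_bubbleNeck_decomposition (hS : ∀ p : S, (𝓝[≠] p).NeBot) {B : ℕ → S → ℝ → Set S}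
    (hB : IsBallSystem B) {μ : ℕ → Measure S} {Λ : ℝ≥0∞} (hΛ : Λ ≠ ⊤) (hμΛ : ∀ k, μ k univ ≤ Λ)
    (hμ : ∀ k p, μ k {p} = 0) {ε : ℝ≥0∞} (hε : 0 < ε) {n : ℕ} {a : Fin n → S}
    (ha : Function.Injective a) :
    ∃ σ : ℕ → ℕ, StrictMono σ ∧ ∃ (Q : Fin n → ℕ) (x : ∀ i, Fin (Q i) → ℕ → S)
      (ρ : ∀ i, Fin (Q i) → ℕ → ℝ) (I : ∀ i, Fin (Q i) → Set (Fin (Q i))),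
      (∀ i j k, 0 < ρ i j k) ∧
      (∀ i j, ∀ c : ℝ, 0 < c → ∀ᶠ k in atTop, x i j k ∈ B (σ k) (a i) c) ∧
      (∀ i j, Tendsto (ρ i j) atTop (𝓝 0)) ∧
      (∀ i j j', j ≠ j' →
        Tendsto (fun k => ρ i j k / ρ i j' k + ρ i j' k / ρ i j k) atTop atTop ∨
        ∀ C : ℝ, ∀ᶠ k in atTop, x i j' k ∉ B (σ k) (x i j k) (C * (ρ i j k + ρ i j' k))) ∧
      (∀ i j k, ε ≤ μ (σ k) (B (σ k) (x i j k) (ρ i j k))) ∧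
      (∀ i l k, {j | x i j k ∈ B (σ k) (x i l k) (ρ i l k) ∧
        Tendsto (fun k' => ρ i l k' / ρ i j k') atTop atTop} = I i l) ∧
      (∀ β : ℝ, 1 < β → ∃ α : ℝ, 0 < α ∧ α < 1 ∧
        (∀ k y r, 0 < r → B (σ k) y (β * (2 * r)) \ B (σ k) y (β⁻¹ * r) ⊆
          neckSet (fun k => B (σ k)) a I x ρ α k →
          μ (σ k) (B (σ k) y (2 * r) \ B (σ k) y r) < ε) ∧
        ∀ i l k, ε ≤ μ (σ k) (B (σ k) (x i l k) (ρ i l k) \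
          ⋃ j ∈ I i l, B (σ k) (x i j k) (α * ρ i l k))) ∧
      (∀ α : ℝ, 0 < α → ∀ i l, ∃ c : ℝ, 0 < c ∧ ∀ᶠ k in atTop, ∀ y r, 0 < r →
        B (σ k) y r ⊆ B (σ k) (x i l k) (α⁻¹ * ρ i l k) \
          ⋃ j ∈ I i l, B (σ k) (x i j k) (α * ρ i l k) →
        ε ≤ μ (σ k) (B (σ k) y r) → c * ρ i l k ≤ r) := by
  set 𝒰 : Ultrafilter ℕ := hyperfilter ℕ
  have h𝒰 : (𝒰 : Filter ℕ) ≤ atTop := Nat.hyperfilter_le_atTop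
  have hfin : ∀ k, IsFiniteMeasure (μ k) := fun k => ⟨(hμΛ k).trans_lt hΛ.lt_top⟩
  choose Q x ρ hx using fun i => exists_isMaximalFamily (𝒰 := 𝒰) hB hΛ hμΛ hε (a i)
  have hρ : ∀ i j k, 0 < ρ i j k := fun i j => ((hx i).bubble j).pos
  set I : ∀ i, Fin (Q i) → Set (Fin (Q i)) := fun i l => {j | IsInner 𝒰 B (x i) (ρ i) l j}
  -- the constants in the properties to be transferred
  have hβ : ∀ N : ℕ, (1 : ℝ) < 1 + 1 / ((N : ℝ) + 1) := fun N => by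
    have : (0 : ℝ) < 1 / ((N : ℝ) + 1) := by positivity
    linarith
  choose αA hαA0 _ hαA using fun N => exists_neckSet_annulus_lt hS h𝒰 hB hμ hε ha hx (hβ N)
  choose αD hαD0 _ hαD using fun i l => (hx i).eventually_le_diff hB l
  choose cR hcR0 hcR using fun (N : ℕ) i l => (hx i).exists_radius_lower_bound h𝒰 hB hμ hε l
    (α := 1 / ((N : ℝ) + 1)) (by positivity)
  have hratio : ∀ i l j, ∃ C : ℝ, ¬ ScaleLT 𝒰 (ρ i j) (ρ i l) →
      ∀ᶠ k in (𝒰 : Filter ℕ), ρ i l k ≤ C * ρ i j k := by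
    intro i l j
    by_cases h : ScaleLT 𝒰 (ρ i j) (ρ i l)
    · exact ⟨0, fun h' => absurd h h'⟩
    · obtain ⟨C, -, hC⟩ := scaleLE_of_not_scaleLT h
      exact ⟨C, fun _ => hC⟩
  choose Cr hCr using hratio
  have hev : ∀ N : ℕ, ∀ᶠ k in (𝒰 : Filter ℕ),
      (∀ i j, x i j k ∈ B k (a i) (1 / ((N : ℝ) + 1) * 1)) ∧
      (∀ i j, ρ i j k < 1 / ((N : ℝ) + 1) * 1) ∧
      (∀ i j, ε ≤ μ k (B k (x i j k) (ρ i j k))) ∧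
      (∀ i l j, WithinScale 𝒰 B (x i l) (x i j) (ρ i l) → x i j k ∈ B k (x i l k) (ρ i l k)) ∧
      (∀ i l j, ¬ WithinScale 𝒰 B (x i l) (x i j) (ρ i l) →
        x i j k ∉ B k (x i l k) (1 * ρ i l k)) ∧
      (∀ i l j, ScaleLT 𝒰 (ρ i j) (ρ i l) → ρ i j k < 1 / ((N : ℝ) + 1) * ρ i l k) ∧
      (∀ i l j, ¬ ScaleLT 𝒰 (ρ i j) (ρ i l) → ρ i l k ≤ Cr i l j * ρ i j k) ∧
      (∀ i j j', ¬ WithinScale 𝒰 B (x i j) (x i j') (fun k => ρ i j k + ρ i j' k) →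
        x i j' k ∉ B k (x i j k) (((N : ℝ) + 1) * (ρ i j k + ρ i j' k))) ∧
      (∀ y r, 0 < r → B k y ((1 + 1 / ((N : ℝ) + 1)) * (2 * r)) \
          B k y ((1 + 1 / ((N : ℝ) + 1))⁻¹ * r) ⊆ neckSet B a I x ρ (αA N) k →
        μ k (B k y (2 * r) \ B k y r) < ε) ∧
      (∀ i l, ε ≤ μ k (B k (x i l k) (ρ i l k) \
        ⋃ j ∈ I i l, B k (x i j k) (αD i l * ρ i l k))) ∧
      (∀ i l, ∀ y r, 0 < r → B k y r ⊆ B k (x i l k) ((1 / ((N : ℝ) + 1))⁻¹ * ρ i l k) \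
          ⋃ j ∈ I i l, B k (x i j k) (1 / ((N : ℝ) + 1) * ρ i l k) →
        ε ≤ μ k (B k y r) → cR N i l * ρ i l k ≤ r) := by
    intro N
    have hN : (0 : ℝ) < 1 / ((N : ℝ) + 1) := by positivity
    refine .and (eventually_all.2 fun i => eventually_all.2 fun j =>
      ((hx i).bubble j).center _ hN) ?_
    refine .and (eventually_all.2 fun i => eventually_all.2 fun j =>
      ((hx i).bubble j).radius _ hN) ?_
    refine .and (eventually_all.2 fun i => eventually_all.2 fun j =>
      ((hx i).bubble j).eventually_le) ?_
    refine .and (eventually_all.2 fun i => eventually_all.2 fun l => eventually_all.2 fun j =>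
      eventually_imp_distrib_left.2 ((hx i).mem_ball l j)) ?_
    refine .and (eventually_all.2 fun i => eventually_all.2 fun l => eventually_all.2 fun j =>
      eventually_imp_distrib_left.2 fun h => eventually_notMem_of_not_within h one_pos) ?_
    refine .and (eventually_all.2 fun i => eventually_all.2 fun l => eventually_all.2 fun j =>
      eventually_imp_distrib_left.2 fun h => h _ hN) ?_
    refine .and (eventually_all.2 fun i => eventually_all.2 fun l => eventually_all.2 fun j =>
      eventually_imp_distrib_left.2 fun h => hCr i l j h) ?_
    refine .and (eventually_all.2 fun i => eventually_all.2 fun j => eventually_all.2 fun j' =>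
      eventually_imp_distrib_left.2 fun h => eventually_notMem_of_not_within h (by positivity)) ?_
    refine (hαA N).and (.and ?_ ?_)
    · exact eventually_all.2 fun i => eventually_all.2 fun l => hαD i l
    · exact eventually_all.2 fun i => eventually_all.2 fun l => hcR N i l
  obtain ⟨σ, hσ, hP⟩ := exists_strictMono_of_eventually h𝒰 hev
  have hsmall : ∀ c : ℝ, 0 < c → ∃ N : ℕ, 1 / ((N : ℝ) + 1) < c := fun c hc =>
    exists_nat_one_div_lt hc
  have hlt : ∀ i l j, ScaleLT 𝒰 (ρ i j) (ρ i l) →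
      Tendsto (fun k => ρ i l (σ k) / ρ i j (σ k)) atTop atTop := by
    intro i l j h
    refine tendsto_atTop.2 fun C => ?_
    obtain ⟨N, hN⟩ := exists_nat_gt C
    filter_upwards [eventually_ge_atTop N] with k hk
    have h1 := (hP N k hk).2.2.2.2.2.1 i l j h
    rw [le_div_iff₀ (hρ i j _)]
    rw [one_div_mul_eq_div, lt_div_iff₀' (by positivity)] at h1
    nlinarith [hρ i j (σ k)]
  have hnlt : ∀ i l j, ¬ ScaleLT 𝒰 (ρ i j) (ρ i l) →
      ¬ Tendsto (fun k => ρ i l (σ k) / ρ i j (σ k)) atTop atTop := by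
    intro i l j h htend
    obtain ⟨k, hk⟩ := (htend.eventually (eventually_gt_atTop (Cr i l j))).exists
    have h1 := (hP 0 k (Nat.zero_le k)).2.2.2.2.2.2.1 i l j h
    rw [lt_div_iff₀ (hρ i j _)] at hk
    linarith
  refine ⟨σ, hσ, Q, fun i j k => x i j (σ k), fun i j k => ρ i j (σ k), I, fun i j k => hρ i j _,
    fun i j c hc => ?_, fun i j => ?_, fun i j j' hjj' => ?_, fun i j k => ?_, fun i l k => ?_,
    fun β hβ1 => ?_, fun α hα i l => ?_⟩
  · obtain ⟨N, hN⟩ := hsmall c hc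
    filter_upwards [eventually_ge_atTop N] with k hk
    exact hB.mono (by linarith) ((hP N k hk).1 i j)
  · refine tendsto_order.2 ⟨fun c hc => Eventually.of_forall fun k => hc.trans (hρ i j _),
      fun c hc => ?_⟩
    obtain ⟨N, hN⟩ := hsmall c hc
    filter_upwards [eventually_ge_atTop N] with k hk
    linarith [(hP N k hk).2.1 i j]
  · rcases (hx i).separated j j' hjj' with h | h | h
    · exact Or.inl (tendsto_atTop_mono (fun k => le_add_of_nonneg_left
        (div_pos (hρ i j _) (hρ i j' _)).le) (hlt i j' j h))
    · exact Or.inl (tendsto_atTop_mono (fun k => le_add_of_nonneg_right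
        (div_pos (hρ i j' _) (hρ i j _)).le) (hlt i j j' h))
    · refine Or.inr fun C => ?_
      obtain ⟨N, hN⟩ := exists_nat_gt C
      filter_upwards [eventually_ge_atTop N] with k hk hmem
      refine (hP N k hk).2.2.2.2.2.2.2.1 i j j' h (hB.mono ?_ hmem)
      exact mul_le_mul_of_nonneg_right (by linarith) (add_pos (hρ i j _) (hρ i j' _)).le
  · exact (hP 0 k (Nat.zero_le k)).2.2.1 i j
  · ext j
    constructor
    · rintro ⟨hmem, htend⟩
      refine ⟨by_contra fun h => hnlt i l j h htend, by_contra fun h => ?_⟩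
      exact (hP 0 k (Nat.zero_le k)).2.2.2.2.1 i l j h (by rwa [one_mul])
    · rintro ⟨h1, h2⟩
      exact ⟨(hP 0 k (Nat.zero_le k)).2.2.2.1 i l j h2, hlt i l j h1⟩
  · obtain ⟨N, hN⟩ := hsmall (β - 1) (by linarith)
    -- for the finitely many `k < N` the whole neck region has small measure
    have hα : ∀ᶠ α in 𝓝[>] (0 : ℝ), (0 < α ∧ α < 1) ∧ α < αA N ∧ (∀ i l, α < αD i l) ∧
        ∀ k ∈ Finset.range N, μ (σ k) (neckSet B a I x ρ α (σ k)) < ε := by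
      refine .and (Ioo_mem_nhdsGT one_pos) (.and ?_ (.and ?_ ?_))
      · filter_upwards [Ioo_mem_nhdsGT (hαA0 N)] with α hα using hα.2
      · refine eventually_all.2 fun i => eventually_all.2 fun l => ?_
        filter_upwards [Ioo_mem_nhdsGT (hαD0 i l)] with α hα using hα.2
      · exact (eventually_all_finset _).2 fun k _ =>
          eventually_measure_neckSet_lt hB hρ (σ k) (μ (σ k)) (hμ (σ k)) hε
    obtain ⟨α, ⟨hα0, hα1⟩, hαA', hαD', hαk⟩ := hα.exists
    refine ⟨α, hα0, hα1, fun k y r hr hsub => ?_, fun i l k => ?_⟩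
    · change _ ⊆ neckSet B a I x ρ α (σ k) at hsub
      rcases lt_or_ge k N with hk | hk
      · refine (measure_mono ?_).trans_lt (hαk k (Finset.mem_range.2 hk))
        refine Subset.trans (sdiff_subset_sdiff (hB.mono ?_) (hB.mono ?_)) hsub
        · nlinarith
        · have := inv_lt_one_of_one_lt₀ hβ1
          nlinarith
      · refine (hP N k hk).2.2.2.2.2.2.2.2.1 y r hr (Subset.trans (sdiff_subset_sdiff (hB.mono ?_)
          (hB.mono ?_)) (hsub.trans (neckSet_mono hB hρ hα0 hαA'.le (σ k))))
        · exact mul_le_mul_of_nonneg_right (by linarith) (by linarith)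
        · refine mul_le_mul_of_nonneg_right (inv_anti₀ (by positivity) (by linarith)) hr.le
    · refine ((hP 0 k (Nat.zero_le k)).2.2.2.2.2.2.2.2.2.1 i l).trans (measure_mono ?_)
      refine sdiff_subset_sdiff Subset.rfl (iUnion₂_mono fun j _ => hB.mono ?_)
      exact mul_le_mul_of_nonneg_right (hαD' i l).le (hρ i l _).le
  · obtain ⟨N, hN⟩ := hsmall α hα
    refine ⟨cR N i l, hcR0 N i l, ?_⟩
    filter_upwards [eventually_ge_atTop N] with k hk y r hr hsub hle
    refine (hP N k hk).2.2.2.2.2.2.2.2.2.2 i l y r hr (hsub.trans ?_) hle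
    refine sdiff_subset_sdiff (hB.mono ?_) (iUnion₂_mono fun j _ => hB.mono ?_)
    · exact mul_le_mul_of_nonneg_right (inv_anti₀ (by positivity) hN.le) (hρ i l _).le
    · exact mul_le_mul_of_nonneg_right hN.le (hρ i l _).le

end Subsequence

end BubbleNeck

/-! ### The decomposition for weak immersions -/

open BubbleNeck in
theorem mainTheorem10
    {S : Type*} [TopologicalSpace S] [T2Space S] [CompactSpace S] [ChartedSpace Plane S]
    [IsManifold (𝓡 2) ∞ S] [MeasurableSpace S] [BorelSpace S]
    {m : ℕ} (hm : 3 ≤ m)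
    -- the sequence of weak immersions, with bounded energy
    (ξ : ℕ → S → EuclideanSpace ℝ (Fin m)) (hξ : ∀ k, IsWeakImmersion (ξ k))
    (Λ : ℝ) (hΛ : ∀ k, gaussEnergy (ξ k) univ ≤ ENNReal.ofReal Λ)
    -- the conformal structures and their convergence
    (h : ℕ → Metric S) (hlim : Metric S)
    (hconf : ∀ k, IsConformalTo (ξ k) (h k))
    (hcurv : ∀ k, HasConstScalarCurvature (h k)) (hcurv_lim : HasConstScalarCurvature hlim)
    (hconv : SmoothConverges h hlim)
    -- the points `a i` and the radius `R`
    {n : ℕ} (a : Fin n → S) (ha : Function.Injective a) (R : ℝ) (hR : 0 < R)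
    (harea : limsup (fun k => Measure.hausdorffMeasure 2 (range (ξ k))) atTop < ⊤)
    (hball : ∀ k, range (ξ k) ⊆ Metric.ball 0 R)
    (ξlim : S → EuclideanSpace ℝ (Fin m)) (hweak : WeakStarConverges ξ ξlim (range a))
    (hlog : LogDiffLocallyBounded ξ h (range a))
    (ε : ℝ) (hε : 0 < ε) (hε' : ε < 8 * Real.pi / 3) :
    ∃ σ : ℕ → ℕ, StrictMono σ ∧
    ∃ (Q : Fin n → ℕ) (x : ∀ i, Fin (Q i) → ℕ → S) (ρ : ∀ i, Fin (Q i) → ℕ → ℝ),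
      (∀ i j k, 0 < ρ i j k) ∧
      -- centers converge to `a i`, radii converge to zero
      (∀ i j, Tendsto (x i j) atTop (𝓝 (a i))) ∧
      (∀ i j, Tendsto (ρ i j) atTop (𝓝 0)) ∧
      -- separation in scale or in position
      (∀ i j j', j ≠ j' →
        Tendsto (fun k => ρ i j k / ρ i j' k + ρ i j' k / ρ i j k) atTop atTop ∨
        Tendsto (fun k => geodDist (h (σ k)) (x i j k) (x i j' k) / (ρ i j k + ρ i j' k))
          atTop atTop) ∧
      -- each bubble carries the energy `ε`
      (∀ i j k, ENNReal.ofReal ε ≤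
        gaussEnergy (ξ (σ k)) (gball (h (σ k)) (x i j k) (ρ i j k))) ∧
      -- the index sets of the contained bubbles do not depend on `k`
      (∀ i j k k', innerBubbles (h ∘ σ) (x i) (ρ i) k j = innerBubbles (h ∘ σ) (x i) (ρ i) k' j) ∧
      (∀ β : ℝ, 1 < β → ∃ α : ℝ, 0 < α ∧ α < 1 ∧
        -- energy of the dyadic annuli in the neck region
        (∀ k, ∀ y : S, ∀ r : ℝ, 0 < r →
          gball (h (σ k)) y (β * (2 * r)) \ gball (h (σ k)) y (β⁻¹ * r) ⊆
            neckRegion (h ∘ σ) a x ρ α k →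
          gaussEnergy (ξ (σ k)) (gball (h (σ k)) y (2 * r) \ gball (h (σ k)) y r) <
            ENNReal.ofReal ε) ∧
        -- energy of each bubble outside of the bubbles it contains
        (∀ i j k, ENNReal.ofReal ε ≤
          gaussEnergy (ξ (σ k)) (bubbleRegion (h ∘ σ) (x i) (ρ i) α k j (ρ i j k)))) ∧
      -- the concentration radius is comparable to the bubble scale
      (∀ α : ℝ, 0 < α → α < 1 → ∀ i j,
        0 < liminf (fun k => concentrationRadius (gaussEnergy (ξ (σ k))) ε (h ∘ σ) (x i) (ρ i) α k j
          / ENNReal.ofReal (ρ i j k)) atTop) := by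
  have hB := hconv.isBallSystem
  have hε0 : 0 < ENNReal.ofReal ε := ENNReal.ofReal_pos.2 hε
  obtain ⟨σ, hσ, Q, x, ρ, I, hρ, hx, hρ0, hsep, hE, hI, hneck, hrad⟩ :=
    exists_bubbleNeck_decomposition (a := a) (μ := fun k => gaussEnergy (ξ k)) punctured_nhds_neBot
      hB ENNReal.ofReal_ne_top hΛ (fun k p => gaussEnergy_singleton (ξ k) p) hε0 ha
  have hinner : ∀ i k j, innerBubbles (h ∘ σ) (x i) (ρ i) k j = I i j := fun i k j => hI i j k
  have hneckRegion : ∀ α k, neckRegion (h ∘ σ) a x ρ α k =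
      neckSet (fun k => gball (h (σ k))) a I x ρ α k := by
    intro α k
    simp only [neckRegion, outerNeck, innerNeck, hinner, neckSet, Function.comp_apply]
  have hbubble : ∀ i α k j r, bubbleRegion (h ∘ σ) (x i) (ρ i) α k j r =
      gball (h (σ k)) (x i j k) r \ ⋃ j' ∈ I i j, gball (h (σ k)) (x i j' k) (α * ρ i j k) := by
    intro i α k j r
    simp only [bubbleRegion, hinner, Function.comp_apply]
  refine ⟨σ, hσ, Q, x, ρ, hρ, fun i j => ?_, hρ0, fun i j j' hjj' => ?_, hE, fun i j k k' => ?_,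
    fun β hβ => ?_, fun α hα _ i j => ?_⟩
  · refine tendsto_nhds.2 fun U hU haU => ?_
    obtain ⟨r, hr, hrU⟩ := hB.exists_eventually_subset (hU.mem_nhds haU)
    filter_upwards [hx i j r hr, hσ.tendsto_atTop.eventually hrU] with k hk hkU
    exact hkU hk
  · refine (hsep i j j' hjj').imp id fun hfar => tendsto_atTop.2 fun C => ?_
    filter_upwards [hfar C, hx i j 1 one_pos, hx i j' 1 one_pos] with k hk hk1 hk2
    -- the distance is finite, so that its real value is not a junk value
    have hfin : geodEDist (h (σ k)) (x i j k) (x i j' k) ≠ ⊤ :=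
      (lt_of_lt_of_le (hB.trans (hB.symm hk1) hk2 :) le_top).ne
    rw [le_div_iff₀ (add_pos (hρ i j k) (hρ i j' k)), geodDist]
    exact (ENNReal.ofReal_le_iff_le_toReal hfin).1 (not_lt.1 hk)
  · rw [hinner, hinner]
  · obtain ⟨α, hα0, hα1, hann, hres⟩ := hneck β hβ
    refine ⟨α, hα0, hα1, fun k y r hr hsub => ?_, fun i j k => ?_⟩
    · rw [hneckRegion] at hsub
      exact hann k y r hr hsub
    · rw [hbubble]
      exact hres i j k
  · obtain ⟨c, hc, hcr⟩ := hrad α hα i j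
    refine (ENNReal.ofReal_pos.2 hc).trans_le (le_liminf_of_le (by isBoundedDefault) ?_)
    filter_upwards [hcr] with k hk
    rw [ENNReal.le_div_iff_mul_le (Or.inl (ENNReal.ofReal_pos.2 (hρ i j k)).ne')
      (Or.inl ENNReal.ofReal_ne_top), ← ENNReal.ofReal_mul hc.le]
    refine le_sInf ?_
    rintro _ ⟨r, rfl, hr, -, y, hsub, hy⟩
    rw [hbubble] at hsub
    exact ENNReal.ofReal_le_ofReal (hk y r hr hsub hy.ge)
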